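/- Let $d\ge 2$ and $0<\sigma<\tfrac12$, and let $R\ge\sqrt d$. Let $\mathrm d\omega$ be the hypersurface measure on the truncated paraboloid $P^{d-1}=\{\xi=(\xi',\xi_d)\in\mathbb R^d:\ \xi_d=|\xi'|^2,\ |\xi_j|\le 1 \text{ for } 1\le j\le d-1\}$, let $$h(\xi)=\sum_{\substack{l\in\mathbb Z^{d-1}\\ 1\le l_1,\dots,l_{d-1}<R^\sigma}}\ \prod_{j=1}^{d-1} 1_{(l_jR^{-\sigma}-R^{-1},\,l_jR^{-\sigma}+R^{-1})}(\xi_j),\qquad g(x)=\int h(\xi)\,e^{2\pi i x\cdot\xi}\,\mathrm d\omega(\xi),$$ so that $\hat g=h\,\mathrm d\omega$. Let $B_R$ be the ball of radius $R$ centred at the origin, let $X$ be the $1$-neighbourhood of $\{(n_1R^\sigma,\dots,n_{d-1}R^\sigma,n_dR^{2\sigma}):n_j\in\mathbb Z\}\cap B_R$, and let $Y$ be the union of the unit cubes $k+[0,1)^d$, $k\in\mathbb Z^d$, that are contained in $B_R$ and meet $X$. Put $\alpha=d-(d+1)\sigma$. Then $\alpha>0$, and the following hold with implied constants that depend only on $d$.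 (i) $Y\subset B_R$ is a finite union of lattice unit cubes, and $|B_r\cap Y|\lesssim r^\alpha$ for all $1\le r\le R$ and all balls $B_r\subset B_R$ of radius $r$. Moreover, for every $K\ge1$, every $\xi'\in[-1,1]^{d-1}$ and every $a\in\mathbb R^d$, the tube of all $x$ for which the components of $x-a$ parallel and orthogonal to the normal $(-2\xi',1)$ of the paraboloid at $(\xi',|\xi'|^2)$ have length at most $KR$ and $KR^{1/2}$ respectively meets at most a fraction $\lesssim K^{d-1}R^{-\frac{d-1}2}$ of the unit cubes that make up $Y$. (So $Y$ and $v=g$, $\varphi=h$ satisfy the hypotheses of the fractal $L^2$ estimate $\|v\|_{L^2(Y)}\lesssim_\varepsilon R^{\frac1{d+1}(\alpha-\frac{d-1}2)+\varepsilon}\|\varphi\|_{L^2(\mathrm d\omega)}$, $\hat v=\varphi\,\mathrm d\omega$.) (ii) $\|g\|_{L^2(Y)}\sim R^{\frac{d-3}2\sigma-\frac{d-2}2}$, and for every $\varepsilon\ge0$ $$R^{\frac1{d+1}\left(\alpha-\frac{d-1}2\right)+\varepsilon}\,\|h\|_{L^2(\mathrm d\omega)}\sim R^{\frac{d-3}2\sigma-\frac{d-2}2+\varepsilon}.$$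 (iii) Consequently the estimate is almost sharp: for every $\beta<\frac1{d+1}\left(\alpha-\frac{d-1}2\right)$ and every $A$ one has $\|g\|_{L^2(Y)}>A\,R^\beta\,\|h\|_{L^2(\mathrm d\omega)}$ for all sufficiently large $R$ (with $\sigma$ fixed). -/

import Mathlib

/-!
Throughout, the ambient space is `ℝ^d` with `d = n + 1`; a point is `ξ = (ξ', ξ_d)` with
`ξ' ∈ ℝ^n` the first `d - 1` coordinates.
-/

noncomputable section

namespace BBCRV

open MeasureTheory

/-- The point `(ξ', |ξ'|²)` of the paraboloid above `ξ' ∈ ℝ^(d-1)`. -/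
def graphPt {n : ℕ} (ξ : EuclideanSpace ℝ (Fin n)) : EuclideanSpace ℝ (Fin (n + 1)) :=
  WithLp.toLp 2 (Fin.snoc (α := fun _ => ℝ) (fun j => ξ j) (‖ξ‖ ^ 2))

/-- The parameter domain `{|ξ_j| ≤ 1}` of the truncated paraboloid. -/
def paramCube (n : ℕ) : Set (EuclideanSpace ℝ (Fin n)) := {ξ | ∀ j, |ξ j| ≤ 1}

/-- The hypersurface measure `dω` on the truncated paraboloid
`{ξ_d = |ξ'|², |ξ_j| ≤ 1 for j ≤ d - 1}`, a measure on `ℝ^d`: the area element of the graph of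
`ξ' ↦ |ξ'|²` is `√(1 + |2 ξ'|²) dξ'`. -/
def surfaceMeasure (n : ℕ) : Measure (EuclideanSpace ℝ (Fin (n + 1))) :=
  ((volume.restrict (paramCube n)).withDensity
    (fun ξ => ENNReal.ofReal (Real.sqrt (1 + 4 * ‖ξ‖ ^ 2)))).map graphPt

/-- The box `∏_j (l_j R^{-σ} - R^{-1}, l_j R^{-σ} + R^{-1})` in the first `d - 1` coordinates. -/
def freqBox {n : ℕ} (σ R : ℝ) (l : Fin n → ℤ) : Set (EuclideanSpace ℝ (Fin (n + 1))) :=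
  {ξ | ∀ j : Fin n, ξ j.castSucc ∈
    Set.Ioo ((l j : ℝ) * R ^ (-σ) - R⁻¹) ((l j : ℝ) * R ^ (-σ) + R⁻¹)}

/-- The density `h`: the sum of the indicators of the boxes over the integer vectors `l` with
`1 ≤ l_j < R^σ` (for an integer, `l_j < R^σ` is the same as `l_j < ⌈R^σ⌉`). -/
def h (n : ℕ) (σ R : ℝ) (ξ : EuclideanSpace ℝ (Fin (n + 1))) : ℂ :=
  ∑ l ∈ Fintype.piFinset (fun _ : Fin n => Finset.Ico (1 : ℤ) ⌈R ^ σ⌉),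
    (freqBox σ R l).indicator (fun _ => (1 : ℂ)) ξ

/-- The Barceló–Bennett–Carbery–Ruiz–Vilela function `g`, the inverse Fourier transform of the
measure `h dω`: `g(x) = ∫ h(ξ) e^{2πi x·ξ} dω(ξ)`. -/
def g (n : ℕ) (σ R : ℝ) (x : EuclideanSpace ℝ (Fin (n + 1))) : ℂ :=
  ∫ ξ, h n σ R ξ * Complex.exp (2 * Real.pi * Complex.I * (inner ℝ x ξ : ℝ)) ∂(surfaceMeasure n)

/-- The points `(n_1 R^σ, …, n_{d-1} R^σ, n_d R^{2σ})` with integers `n_j`. -/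
def peakLattice (n : ℕ) (σ R : ℝ) : Set (EuclideanSpace ℝ (Fin (n + 1))) :=
  {x | ∃ m : Fin (n + 1) → ℤ, (∀ j : Fin n, x j.castSucc = (m j.castSucc : ℝ) * R ^ σ) ∧
    x (Fin.last n) = (m (Fin.last n) : ℝ) * R ^ (2 * σ)}

/-- The set `X`: the `1`-neighbourhood of the points of the peak lattice in `B_R`. -/
def peakNbhd (n : ℕ) (σ R : ℝ) : Set (EuclideanSpace ℝ (Fin (n + 1))) :=
  Metric.thickening 1 (peakLattice n σ R ∩ Metric.ball 0 R)

/-- The lattice unit cube with lowest corner `k ∈ ℤ^d`. -/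
def unitCube {m : ℕ} (k : Fin m → ℤ) : Set (EuclideanSpace ℝ (Fin m)) :=
  {x | ∀ i, (k i : ℝ) ≤ x i ∧ x i < (k i : ℝ) + 1}

/-- The union of a collection of lattice unit cubes. -/
def cubeUnion {m : ℕ} (Q : Set (Fin m → ℤ)) : Set (EuclideanSpace ℝ (Fin m)) :=
  ⋃ k ∈ Q, unitCube k

/-- The lattice unit cubes that lie in `B_R` and meet `X`; their union is `Y`. -/
def peakCubes (n : ℕ) (σ R : ℝ) : Set (Fin (n + 1) → ℤ) :=
  {k | unitCube k ⊆ Metric.ball 0 R ∧ (unitCube k ∩ peakNbhd n σ R).Nonempty}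

/-- Fractal structure of dimension `α` between the scales `1` and `R`, with implied constant `A`:
`|B_r ∩ Y| ≤ A r^α` for all `1 ≤ r ≤ R` and all balls `B_r ⊆ B_R`. -/
def HasFractalStructure {m : ℕ} (A α R : ℝ) (Y : Set (EuclideanSpace ℝ (Fin m))) : Prop :=
  ∀ (x : EuclideanSpace ℝ (Fin m)) (r : ℝ), 1 ≤ r → r ≤ R →
    Metric.ball x r ⊆ Metric.ball 0 R →
      volume (Metric.ball x r ∩ Y) ≤ ENNReal.ofReal (A * r ^ α)

/-- The upward normal vector `(-2 ξ', 1)` of the paraboloid at `(ξ', |ξ'|²)`. -/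
def normalVec {n : ℕ} (ξ : EuclideanSpace ℝ (Fin n)) : EuclideanSpace ℝ (Fin (n + 1)) :=
  WithLp.toLp 2 (Fin.snoc (α := fun _ => ℝ) (fun j => -2 * ξ j) 1)

/-- The tube with centre `a`, thickness `K R^{1/2}` and length `K R` (up to factors `2`) in the
direction normal to the paraboloid at `(ξ', |ξ'|²)`: the points whose difference with `a` has
component of length at most `K R` along the normal line and at most `K R^{1/2}` orthogonally
to it. -/
def tube {n : ℕ} (K R : ℝ) (ξ : EuclideanSpace ℝ (Fin n))
    (a : EuclideanSpace ℝ (Fin (n + 1))) : Set (EuclideanSpace ℝ (Fin (n + 1))) :=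
  {x | ‖(Submodule.span ℝ {normalVec ξ}).starProjection (x - a)‖ ≤ K * R ∧
    ‖(x - a) - (Submodule.span ℝ {normalVec ξ}).starProjection (x - a)‖ ≤ K * R ^ (1 / 2 : ℝ)}

/-- Each wave packet tube at scale `R` (any position, direction normal to the truncated
paraboloid, essential support enlarged by any factor `K ≥ 1`) hits at most the fraction
`A K^(d-1) R^{-(d-1)/2}` of the unit cubes of the collection `Q`. -/
def TubesHitSmallFraction {n : ℕ} (A R : ℝ) (Q : Set (Fin (n + 1) → ℤ)) : Prop :=
  ∀ K : ℝ, 1 ≤ K → ∀ ξ ∈ paramCube n, ∀ a : EuclideanSpace ℝ (Fin (n + 1)),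
    ({k ∈ Q | (unitCube k ∩ tube K R ξ a).Nonempty}.ncard : ℝ) ≤
      A * K ^ n * R ^ (-(n : ℝ) / 2) * (Q.ncard : ℝ)

end BBCRV

end

noncomputable section

namespace BBCRV

open MeasureTheory

/-! Write `d = n + 1`. Both norms are computed up to constants, and their powers of `R` agree once
the factor `R^(1/2 - σ)` of the estimate is included.

Size of `h`: there are about `R^(nσ)` boxes, each of surface measure about `R^(-n)`, so `‖h‖₁ ~
R^(n(σ-1))`. As `h` takes integer values between `0` and `3^n`, `‖h‖₂² ~ ‖h‖₁`.

Size of `g`: on the paraboloid the phase is `x·ξ = ∑_j (x_j ξ_j + x_d ξ_j²)`. At `x_j = m_j R^σ`,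
`x_d = m_d R^(2σ)`, `ξ_j = l_j R^(-σ)` it is the integer `∑_j (m_j l_j + m_d l_j²)`. Moving `ξ_j` by
`R⁻¹` and `x` by a small constant `δ` changes it little as long as the lattice point has coordinates
at most `δR` (`abs_phase_coord_le`). Hence nothing cancels near such points and `|g| ≳ ‖h‖₁` there
(`le_norm_g_of_near`), while `|g| ≤ ‖h‖₁` everywhere. There are about `R^α` such points and `|Y| ~
R^α`, so `‖g‖_{L²(Y)} ~ R^(n(σ-1) + α/2)`.

Geometry of `Y`: every cube of `Y` is near a lattice point and `O(1)` cubes share one, so both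
hypotheses on `Y` are counts of lattice points in a possibly slanted box
(`ncard_le_of_near_lattice`). -/

/-! ### The `L¹` norm of `h`. -/

/-- The index set of the frequency boxes. -/
def boxIndices (n : ℕ) (σ R : ℝ) : Finset (Fin n → ℤ) :=
  Fintype.piFinset (fun _ : Fin n => Finset.Ico (1 : ℤ) ⌈R ^ σ⌉)

open Classical in
/-- The number of frequency boxes that contain `ξ`. -/
def boxCount (n : ℕ) (σ R : ℝ) (ξ : EuclideanSpace ℝ (Fin (n + 1))) : ℕ :=
  ((boxIndices n σ R).filter (fun l => ξ ∈ freqBox σ R l)).card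

theorem h_eq_boxCount (n : ℕ) (σ R : ℝ) (ξ : EuclideanSpace ℝ (Fin (n + 1))) :
    h n σ R ξ = (boxCount n σ R ξ : ℂ) := by
  classical
  simp only [h, boxCount, boxIndices, Set.indicator_apply, Finset.sum_boole]

theorem enorm_h (n : ℕ) (σ R : ℝ) (ξ : EuclideanSpace ℝ (Fin (n + 1))) :
    ‖h n σ R ξ‖ₑ = ∑ l ∈ boxIndices n σ R, (freqBox σ R l).indicator 1 ξ := by
  classical
  have h1 : ‖h n σ R ξ‖ₑ = (boxCount n σ R ξ : ENNReal) := by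
    rw [h_eq_boxCount, ← ofReal_norm]
    simp
  rw [h1]
  simp only [boxCount, Set.indicator_apply, Pi.one_apply, Finset.sum_boole]

theorem measurableSet_freqBox {n : ℕ} (σ R : ℝ) (l : Fin n → ℤ) :
    MeasurableSet (freqBox σ R l) := by
  have : freqBox σ R l = ⋂ j : Fin n, (fun ξ : EuclideanSpace ℝ (Fin (n + 1)) => ξ j.castSucc) ⁻¹'
      Set.Ioo ((l j : ℝ) * R ^ (-σ) - R⁻¹) ((l j : ℝ) * R ^ (-σ) + R⁻¹) := by
    ext ξ; simp [freqBox]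
  rw [this]
  exact MeasurableSet.iInter fun j => measurableSet_Ioo.preimage (by fun_prop)

theorem measurableSet_paramCube (n : ℕ) : MeasurableSet (paramCube n) := by
  have : paramCube n = ⋂ j : Fin n, (fun ξ : EuclideanSpace ℝ (Fin n) => |ξ j|) ⁻¹'
      Set.Iic 1 := by
    ext ξ; simp [paramCube]
  rw [this]
  exact MeasurableSet.iInter fun j => measurableSet_Iic.preimage (by fun_prop)

theorem measurable_h (n : ℕ) (σ R : ℝ) : Measurable (h n σ R) := by
  unfold h
  exact Finset.measurable_fun_sum _ fun l _ => measurable_const.indicator (measurableSet_freqBox σ R l)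

@[simp]
theorem graphPt_castSucc {n : ℕ} (ξ : EuclideanSpace ℝ (Fin n)) (j : Fin n) :
    graphPt ξ j.castSucc = ξ j := by
  simp [graphPt]

@[simp]
theorem graphPt_last {n : ℕ} (ξ : EuclideanSpace ℝ (Fin n)) :
    graphPt ξ (Fin.last n) = ‖ξ‖ ^ 2 := by
  simp [graphPt]

theorem measurable_graphPt (n : ℕ) : Measurable (graphPt (n := n)) := by
  refine (WithLp.measurable_toLp 2 _).comp (measurable_pi_lambda _ fun i => ?_)
  refine Fin.lastCases ?_ (fun j => ?_) i
  · simp only [Fin.snoc_last]; fun_prop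
  · simp only [Fin.snoc_castSucc]; fun_prop

/-- The measure of a coordinate box in Euclidean space. -/
theorem volume_coordBox {n : ℕ} (I : Fin n → Set ℝ) :
    volume {ξ : EuclideanSpace ℝ (Fin n) | ∀ j, ξ j ∈ I j} = ∏ j, volume (I j) := by
  rw [← volume_pi_pi, ← (EuclideanSpace.volume_preserving_symm_measurableEquiv_toLp
    (Fin n)).measure_preimage_equiv]
  congr 1
  ext ξ
  simp [Set.mem_pi]

theorem norm_sq_le_of_mem_paramCube {n : ℕ} {ξ : EuclideanSpace ℝ (Fin n)}
    (hξ : ξ ∈ paramCube n) : ‖ξ‖ ^ 2 ≤ n := by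
  rw [EuclideanSpace.norm_sq_eq]
  calc ∑ i, ‖ξ i‖ ^ 2 ≤ ∑ _i : Fin n, (1 : ℝ) :=
        Finset.sum_le_sum fun i _ => pow_le_one₀ (norm_nonneg _) (hξ i)
    _ = n := by simp

/-- Over the parameter cube the area density `√(1 + 4‖ξ‖²)` lies between `1` and `1 + 4n`; this and
`le_surfaceMeasure` reduce surface measure to Lebesgue measure. -/
theorem surfaceMeasure_le {n : ℕ} {A : Set (EuclideanSpace ℝ (Fin (n + 1)))}
    (hA : MeasurableSet A) :
    surfaceMeasure n A ≤ ENNReal.ofReal (1 + 4 * n) * volume (graphPt ⁻¹' A) := by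
  have hA' := measurable_graphPt n hA
  rw [surfaceMeasure, Measure.map_apply (measurable_graphPt n) hA, withDensity_apply _ hA',
    Measure.restrict_restrict hA']
  calc _ ≤ ∫⁻ _ in graphPt ⁻¹' A ∩ paramCube n, ENNReal.ofReal (1 + 4 * n) := by
        refine setLIntegral_mono' (hA'.inter (measurableSet_paramCube n)) fun ξ hξ => ?_
        refine ENNReal.ofReal_le_ofReal ?_
        have h1 := norm_sq_le_of_mem_paramCube hξ.2
        rw [Real.sqrt_le_left (by positivity)]
        nlinarith [sq_nonneg (n : ℝ)]
    _ = ENNReal.ofReal (1 + 4 * n) * volume (graphPt ⁻¹' A ∩ paramCube n) := by simp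
    _ ≤ _ := by gcongr; exact Set.inter_subset_left

theorem le_surfaceMeasure {n : ℕ} {A : Set (EuclideanSpace ℝ (Fin (n + 1)))}
    (hA : MeasurableSet A) :
    volume (graphPt ⁻¹' A ∩ paramCube n) ≤ surfaceMeasure n A := by
  have hA' := measurable_graphPt n hA
  rw [surfaceMeasure, Measure.map_apply (measurable_graphPt n) hA, withDensity_apply _ hA',
    Measure.restrict_restrict hA']
  calc _ = ∫⁻ _ in graphPt ⁻¹' A ∩ paramCube n, 1 := by simp
    _ ≤ _ := by
        refine setLIntegral_mono' (hA'.inter (measurableSet_paramCube n)) fun ξ hξ => ?_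
        rw [ENNReal.one_le_ofReal, Real.one_le_sqrt]
        nlinarith [sq_nonneg ‖ξ‖]

theorem surfaceMeasure_freqBox_le {n : ℕ} {σ R : ℝ} (hR : 0 < R) (l : Fin n → ℤ) :
    surfaceMeasure n (freqBox σ R l) ≤ ENNReal.ofReal ((1 + 4 * n) * (2 * R⁻¹) ^ n) := by
  refine (surfaceMeasure_le (measurableSet_freqBox σ R l)).trans ?_
  have : graphPt ⁻¹' freqBox σ R l = {ξ : EuclideanSpace ℝ (Fin n) | ∀ j, ξ j ∈
      Set.Ioo ((l j : ℝ) * R ^ (-σ) - R⁻¹) ((l j : ℝ) * R ^ (-σ) + R⁻¹)} := by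
    ext ξ; simp [freqBox]
  rw [this, volume_coordBox]
  simp only [Real.volume_Ioo]
  rw [ENNReal.ofReal_mul (by positivity), ENNReal.ofReal_pow (by positivity)]
  simp only [add_sub_sub_cancel, Finset.prod_const, Finset.card_univ, Fintype.card_fin, two_mul]
  rfl

theorem mem_boxIndices {n : ℕ} {σ R : ℝ} {l : Fin n → ℤ} :
    l ∈ boxIndices n σ R ↔ ∀ j, 1 ≤ l j ∧ (l j : ℝ) < R ^ σ := by
  simp [boxIndices, Int.lt_ceil]

theorem mul_rpow_neg_lt_one {σ R : ℝ} (hR : 0 < R) {k : ℝ} (hk : k < R ^ σ) :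
    k * R ^ (-σ) < 1 := by
  have := Real.rpow_pos_of_pos hR σ
  rw [Real.rpow_neg hR.le, ← div_eq_mul_inv, div_lt_one this]
  exact hk

theorem le_surfaceMeasure_freqBox {n : ℕ} {σ R : ℝ} (hR : 1 ≤ R) {l : Fin n → ℤ}
    (hl : l ∈ boxIndices n σ R) :
    ENNReal.ofReal (R⁻¹ ^ n) ≤ surfaceMeasure n (freqBox σ R l) := by
  have hR0 : 0 < R := by linarith
  refine le_trans ?_ (le_surfaceMeasure (measurableSet_freqBox σ R l))
  -- Only the lower half of each interval is used: the upper half may leave `|ξ_j| ≤ 1` when `l_j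
  -- R^(-σ)` is close to `1`.
  have hsub : {ξ : EuclideanSpace ℝ (Fin n) | ∀ j, ξ j ∈
      Set.Ioo ((l j : ℝ) * R ^ (-σ) - R⁻¹) ((l j : ℝ) * R ^ (-σ))} ⊆
      graphPt ⁻¹' freqBox σ R l ∩ paramCube n := by
    intro ξ hξ
    have hRi : R⁻¹ ≤ 1 := inv_le_one_of_one_le₀ hR
    have hRi0 : 0 < R⁻¹ := by positivity
    refine ⟨fun j => ?_, fun j => ?_⟩
    · rw [graphPt_castSucc]
      exact ⟨(hξ j).1, by linarith [(hξ j).2]⟩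
    · have h1 := hξ j
      have h2 := mem_boxIndices.1 hl j
      have h3 : (1 : ℝ) ≤ l j := by exact_mod_cast h2.1
      have h4 := mul_rpow_neg_lt_one hR0 h2.2
      have h5 : 0 ≤ (l j : ℝ) * R ^ (-σ) := by positivity
      rw [abs_le]
      exact ⟨by linarith [h1.1], by linarith [h1.2]⟩
  refine le_trans ?_ (measure_mono hsub)
  rw [volume_coordBox]
  simp only [Real.volume_Ioo, sub_sub_cancel, Finset.prod_const, Finset.card_univ,
    Fintype.card_fin]
  rw [ENNReal.ofReal_pow (by positivity)]

theorem card_boxIndices (n : ℕ) (σ R : ℝ) :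
    (boxIndices n σ R).card = (⌈R ^ σ⌉ - 1).toNat ^ n := by
  simp [boxIndices]

theorem toNat_ceil_sub_one_bounds {t : ℝ} (ht : 1 < t) :
    t / 2 ≤ ((⌈t⌉ - 1).toNat : ℝ) ∧ ((⌈t⌉ - 1).toNat : ℝ) ≤ t := by
  have h1 : (2 : ℤ) ≤ ⌈t⌉ := by
    have : (1 : ℤ) < ⌈t⌉ := by rw [Int.lt_ceil]; simpa using ht
    omega
  have h2 : ((⌈t⌉ - 1).toNat : ℝ) = (⌈t⌉ : ℝ) - 1 := by
    have : (((⌈t⌉ - 1).toNat : ℤ) : ℝ) = ((⌈t⌉ - 1 : ℤ) : ℝ) := by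
      rw [Int.toNat_of_nonneg (by omega)]
    push_cast at this
    exact_mod_cast this
  have h3 := Int.le_ceil t
  have h4 := Int.ceil_lt_add_one t
  have h5 : (2 : ℝ) ≤ ⌈t⌉ := by exact_mod_cast h1
  rw [h2]
  constructor <;> linarith

theorem rpow_sub_one_mul {R : ℝ} (hR : 0 < R) (n : ℕ) (σ : ℝ) :
    R ^ ((n : ℝ) * (σ - 1)) = (R ^ σ) ^ n * R⁻¹ ^ n := by
  rw [mul_comm, Real.rpow_mul_natCast hR.le, Real.rpow_sub_one hR.ne', div_eq_mul_inv, mul_pow]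

theorem lintegral_enorm_h (n : ℕ) (σ R : ℝ) :
    ∫⁻ ξ, ‖h n σ R ξ‖ₑ ∂(surfaceMeasure n) =
      ∑ l ∈ boxIndices n σ R, surfaceMeasure n (freqBox σ R l) := by
  simp_rw [enorm_h]
  rw [lintegral_finsetSum _ fun l _ =>
    measurable_one.indicator (measurableSet_freqBox σ R l)]
  simp [measurableSet_freqBox]

theorem le_lintegral_enorm_h (n : ℕ) {σ R : ℝ} (hσ : 0 < σ) (hR : 1 < R) :
    ENNReal.ofReal ((1 / 2) ^ n * R ^ ((n : ℝ) * (σ - 1))) ≤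
      ∫⁻ ξ, ‖h n σ R ξ‖ₑ ∂(surfaceMeasure n) := by
  have hR0 : 0 < R := by linarith
  rw [lintegral_enorm_h]
  refine le_trans ?_ (Finset.card_nsmul_le_sum _ _ _ fun l hl => le_surfaceMeasure_freqBox hR.le hl)
  rw [card_boxIndices, nsmul_eq_mul, ← ENNReal.ofReal_natCast,
    ← ENNReal.ofReal_mul (by positivity)]
  refine ENNReal.ofReal_le_ofReal ?_
  have h1 := (toNat_ceil_sub_one_bounds (Real.one_lt_rpow hR hσ)).1
  rw [rpow_sub_one_mul hR0, ← mul_assoc, ← mul_pow]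
  push_cast
  gcongr
  linarith

theorem lintegral_enorm_h_le (n : ℕ) {σ R : ℝ} (hσ : 0 < σ) (hR : 1 < R) :
    ∫⁻ ξ, ‖h n σ R ξ‖ₑ ∂(surfaceMeasure n) ≤
      ENNReal.ofReal ((1 + 4 * n) * 2 ^ n * R ^ ((n : ℝ) * (σ - 1))) := by
  have hR0 : 0 < R := by linarith
  rw [lintegral_enorm_h]
  refine (Finset.sum_le_card_nsmul _ _ _ fun l _ => surfaceMeasure_freqBox_le hR0 l).trans ?_
  rw [card_boxIndices, nsmul_eq_mul, ← ENNReal.ofReal_natCast,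
    ← ENNReal.ofReal_mul (by positivity)]
  refine ENNReal.ofReal_le_ofReal ?_
  have h1 := (toNat_ceil_sub_one_bounds (Real.one_lt_rpow hR hσ)).2
  rw [rpow_sub_one_mul hR0, mul_pow]
  push_cast
  calc _ ≤ (R ^ σ) ^ n * ((1 + 4 * ↑n) * (2 ^ n * R⁻¹ ^ n)) := by gcongr
    _ = _ := by ring

/-! ### Counting multiples, bounded overlap of the boxes, and the `L²` norm of `h`. -/

/-- The integers `m` with `|m s - t| ≤ ρ`. -/
def multiplesNear (s t ρ : ℝ) : Finset ℤ := Finset.Icc ⌈(t - ρ) / s⌉ ⌊(t + ρ) / s⌋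

theorem mem_multiplesNear {s t ρ : ℝ} (hs : 0 < s) {m : ℤ} :
    m ∈ multiplesNear s t ρ ↔ |m * s - t| ≤ ρ := by
  rw [multiplesNear, Finset.mem_Icc, Int.ceil_le, Int.le_floor, div_le_iff₀ hs, le_div_iff₀ hs,
    abs_le]
  constructor <;> rintro ⟨h1, h2⟩ <;> constructor <;> linarith

theorem card_multiplesNear_le {s t ρ : ℝ} (hs : 0 < s) (hρ : 0 ≤ ρ) :
    ((multiplesNear s t ρ).card : ℝ) ≤ 2 * ρ / s + 1 := by
  rw [multiplesNear, Int.card_Icc]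
  have h3 : ((⌊(t + ρ) / s⌋ + 1 - ⌈(t - ρ) / s⌉).toNat : ℝ) =
      ((max (⌊(t + ρ) / s⌋ + 1 - ⌈(t - ρ) / s⌉) 0 : ℤ) : ℝ) := by
    rw [← Int.toNat_eq_max]; push_cast; rfl
  rw [h3]
  push_cast
  refine max_le ?_ (by positivity)
  have h4 := Int.floor_le ((t + ρ) / s)
  have h5 := Int.le_ceil ((t - ρ) / s)
  have h6 : 2 * ρ / s = (t + ρ) / s - (t - ρ) / s := by ring
  linarith

theorem boxCount_le (n : ℕ) {σ R : ℝ} (hσ : σ ≤ 1) (hR : 1 ≤ R)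
    (ξ : EuclideanSpace ℝ (Fin (n + 1))) : boxCount n σ R ξ ≤ 3 ^ n := by
  classical
  have hR0 : 0 < R := by linarith
  have hs : 0 < R ^ (-σ) := by positivity
  set I : Fin n → Finset ℤ := fun j => multiplesNear (R ^ (-σ)) (ξ j.castSucc) R⁻¹ with hI
  have hsub : (boxIndices n σ R).filter (fun l => ξ ∈ freqBox σ R l) ⊆ Fintype.piFinset I := by
    intro l hl
    rw [Fintype.mem_piFinset]
    intro j
    have := (Finset.mem_filter.1 hl).2 j
    rw [mem_multiplesNear hs, abs_le]
    exact ⟨by linarith [this.2], by linarith [this.1]⟩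
  refine (Finset.card_le_card hsub).trans ?_
  rw [Fintype.card_piFinset]
  calc ∏ j, (I j).card ≤ ∏ _j : Fin n, 3 := by
        refine Finset.prod_le_prod' fun j _ => ?_
        have h1 : ((I j).card : ℝ) ≤ _ := card_multiplesNear_le hs (inv_pos.2 hR0).le
        -- For small `R` the boxes can overlap, but `R⁻¹ ≤ R^(-σ)` leaves at most three choices per
        -- coordinate.
        have h2 : 2 * R⁻¹ / R ^ (-σ) ≤ 2 := by
          rw [div_le_iff₀ (by positivity)]
          have : R⁻¹ ≤ R ^ (-σ) := by
            rw [← Real.rpow_neg_one]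
            exact Real.rpow_le_rpow_of_exponent_le hR (by linarith)
          linarith
        have : ((I j).card : ℝ) ≤ 3 := by linarith
        exact_mod_cast this
    _ = 3 ^ n := by simp

theorem eLpNorm_two_eq {E F : Type*} [MeasurableSpace E] [NormedAddCommGroup F] (f : E → F)
    (μ : Measure E) : eLpNorm f 2 μ = (∫⁻ x, ‖f x‖ₑ ^ 2 ∂μ) ^ (1 / 2 : ℝ) := by
  rw [eLpNorm_eq_lintegral_rpow_enorm_toReal (by simp) (by simp)]
  simp

/-- A natural number is at most its square, so the `L¹` lower bound passes to `L²`. -/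
theorem enorm_h_le_sq (n : ℕ) (σ R : ℝ) (ξ : EuclideanSpace ℝ (Fin (n + 1))) :
    ‖h n σ R ξ‖ₑ ≤ ‖h n σ R ξ‖ₑ ^ 2 := by
  rw [h_eq_boxCount, ← ofReal_norm]
  simp only [Complex.norm_natCast, ENNReal.ofReal_natCast]
  exact_mod_cast Nat.le_self_pow two_ne_zero _

theorem enorm_h_sq_le (n : ℕ) {σ R : ℝ} (hσ : σ ≤ 1) (hR : 1 ≤ R)
    (ξ : EuclideanSpace ℝ (Fin (n + 1))) : ‖h n σ R ξ‖ₑ ^ 2 ≤ 3 ^ n * ‖h n σ R ξ‖ₑ := by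
  rw [h_eq_boxCount, ← ofReal_norm]
  simp only [Complex.norm_natCast, ENNReal.ofReal_natCast]
  have := boxCount_le n hσ hR ξ
  rw [sq]
  gcongr
  exact_mod_cast this

theorem ofReal_rpow_half {a R e : ℝ} (ha : 0 ≤ a) (hR : 0 ≤ R) :
    ENNReal.ofReal (a * R ^ e) ^ (1 / 2 : ℝ) = ENNReal.ofReal (√a * R ^ (e / 2)) := by
  rw [ENNReal.ofReal_rpow_of_nonneg (by positivity) (by norm_num),
    Real.mul_rpow ha (by positivity), ← Real.sqrt_eq_rpow, ← Real.rpow_mul hR]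
  ring_nf

theorem le_eLpNorm_h (n : ℕ) {σ R : ℝ} (hσ : 0 < σ) (hR : 1 < R) :
    ENNReal.ofReal (√((1 / 2) ^ n) * R ^ ((n : ℝ) * (σ - 1) / 2)) ≤
      eLpNorm (h n σ R) 2 (surfaceMeasure n) := by
  rw [← ofReal_rpow_half (by positivity) (by linarith), eLpNorm_two_eq]
  refine ENNReal.rpow_le_rpow ?_ (by norm_num)
  exact (le_lintegral_enorm_h n hσ hR).trans (lintegral_mono fun ξ => enorm_h_le_sq n σ R ξ)

theorem eLpNorm_h_le (n : ℕ) {σ R : ℝ} (hσ : 0 < σ) (hσ1 : σ ≤ 1) (hR : 1 < R) :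
    eLpNorm (h n σ R) 2 (surfaceMeasure n) ≤
      ENNReal.ofReal (√(3 ^ n * ((1 + 4 * n) * 2 ^ n)) * R ^ ((n : ℝ) * (σ - 1) / 2)) := by
  rw [← ofReal_rpow_half (by positivity) (by linarith), eLpNorm_two_eq]
  refine ENNReal.rpow_le_rpow ?_ (by norm_num)
  calc _ ≤ ∫⁻ ξ, 3 ^ n * ‖h n σ R ξ‖ₑ ∂(surfaceMeasure n) :=
        lintegral_mono fun ξ => enorm_h_sq_le n hσ1 hR.le ξ
    _ = 3 ^ n * ∫⁻ ξ, ‖h n σ R ξ‖ₑ ∂(surfaceMeasure n) :=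
        lintegral_const_mul _ (measurable_h n σ R).enorm
    _ ≤ 3 ^ n * ENNReal.ofReal ((1 + 4 * n) * 2 ^ n * R ^ ((n : ℝ) * (σ - 1))) := by
        gcongr; exact lintegral_enorm_h_le n hσ hR
    _ = _ := by
        rw [mul_assoc (3 ^ n : ℝ), ENNReal.ofReal_mul (by positivity : (0 : ℝ) ≤ 3 ^ n),
          ENNReal.ofReal_pow (by norm_num)]
        simp

/-! ### Counting lattice points and cubes; fractal structure and tubes. -/

/-- The side lengths `(R^σ, …, R^σ, R^{2σ})` of the fundamental cell of the peak lattice. -/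
def spacing (n : ℕ) (σ R : ℝ) : Fin (n + 1) → ℝ :=
  Fin.snoc (α := fun _ => ℝ) (fun _ => R ^ σ) (R ^ (2 * σ))

@[simp]
theorem spacing_castSucc (n : ℕ) (σ R : ℝ) (j : Fin n) : spacing n σ R j.castSucc = R ^ σ := by
  simp [spacing]

@[simp]
theorem spacing_last (n : ℕ) (σ R : ℝ) : spacing n σ R (Fin.last n) = R ^ (2 * σ) := by
  simp [spacing]

theorem one_le_spacing (n : ℕ) {σ R : ℝ} (hσ : 0 ≤ σ) (hR : 1 ≤ R) (i : Fin (n + 1)) :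
    1 ≤ spacing n σ R i := by
  refine Fin.lastCases ?_ (fun j => ?_) i
  · rw [spacing_last]; exact Real.one_le_rpow hR (by linarith)
  · rw [spacing_castSucc]; exact Real.one_le_rpow hR hσ

theorem mem_peakLattice {n : ℕ} {σ R : ℝ} {x : EuclideanSpace ℝ (Fin (n + 1))} :
    x ∈ peakLattice n σ R ↔ ∃ m : Fin (n + 1) → ℤ, ∀ i, x i = m i * spacing n σ R i := by
  refine exists_congr fun m => ?_
  rw [Fin.forall_fin_succ']
  simp

/-- Count the last coordinate first, then the others in each fibre. The centre `t` may depend on the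
last coordinate: it is constant for balls and follows the slanted axis for tubes. -/
theorem card_le_of_shear {n : ℕ} {S : Finset (Fin (n + 1) → ℤ)} {s ρ s' t' ρ' : ℝ}
    (t : ℤ → Fin n → ℝ) (hs : 0 < s) (hs' : 0 < s') (hρ : 0 ≤ ρ) (hρ' : 0 ≤ ρ')
    (hS' : ∀ m ∈ S, |m (Fin.last n) * s' - t'| ≤ ρ')
    (hS : ∀ m ∈ S, ∀ j : Fin n, |m j.castSucc * s - t (m (Fin.last n)) j| ≤ ρ) :
    (S.card : ℝ) ≤ (2 * ρ / s + 1) ^ n * (2 * ρ' / s' + 1) := by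
  classical
  set T : Finset (Σ _ : ℤ, Fin n → ℤ) := (multiplesNear s' t' ρ').sigma
    fun z => Fintype.piFinset fun j => multiplesNear s (t z j) ρ with hT
  have hsub : S ⊆ T.image fun p => Fin.snoc (α := fun _ => ℤ) p.2 p.1 := by
    intro m hm
    refine Finset.mem_image.2 ⟨⟨m (Fin.last n), fun j => m j.castSucc⟩, ?_, ?_⟩
    · rw [hT, Finset.mem_sigma, Fintype.mem_piFinset]
      exact ⟨(mem_multiplesNear hs').2 (hS' m hm), fun j => (mem_multiplesNear hs).2 (hS m hm j)⟩
    · exact Fin.snoc_init_self m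
  have h1 : (S.card : ℝ) ≤ T.card := by
    exact_mod_cast (Finset.card_le_card hsub).trans Finset.card_image_le
  refine h1.trans ?_
  rw [hT, Finset.card_sigma]
  push_cast
  calc _ ≤ ∑ _z ∈ multiplesNear s' t' ρ', (2 * ρ / s + 1) ^ n := by
        refine Finset.sum_le_sum fun z _ => ?_
        rw [Fintype.card_piFinset]
        push_cast
        calc _ ≤ ∏ _j : Fin n, (2 * ρ / s + 1) :=
              Finset.prod_le_prod (fun _ _ => by positivity) fun j _ => card_multiplesNear_le hs hρ
          _ = _ := by simp
    _ = (multiplesNear s' t' ρ').card * (2 * ρ / s + 1) ^ n := by simp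
    _ ≤ _ := by
        rw [mul_comm]
        gcongr
        exact card_multiplesNear_le hs' hρ'

theorem card_le_of_near {m : ℕ} {F : Finset (Fin m → ℤ)} (c : Fin m → ℝ)
    (hF : ∀ k ∈ F, ∀ i, |k i - c i| ≤ 2) : F.card ≤ 5 ^ m := by
  classical
  have hsub : F ⊆ Fintype.piFinset fun i => multiplesNear 1 (c i) 2 := by
    intro k hk
    rw [Fintype.mem_piFinset]
    intro i
    rw [mem_multiplesNear one_pos, mul_one]
    exact hF k hk i
  refine (Finset.card_le_card hsub).trans ?_
  rw [Fintype.card_piFinset]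
  calc _ ≤ ∏ _i : Fin m, 5 := by
        refine Finset.prod_le_prod' fun i _ => ?_
        have : ((multiplesNear 1 (c i) 2).card : ℝ) ≤ 5 :=
          (card_multiplesNear_le one_pos (by norm_num)).trans (by norm_num)
        exact_mod_cast this
    _ = 5 ^ m := by simp

/-- A collection of unit cubes, each close to a lattice point in a sheared box, has at most `5^d`
times as many members as there can be lattice points in that box. -/
theorem ncard_le_of_near_lattice {n : ℕ} {σ R ρ t' ρ' : ℝ} {Q : Set (Fin (n + 1) → ℤ)}
    (hR : 0 < R) (t : ℤ → Fin n → ℝ) (hρ : 0 ≤ ρ) (hρ' : 0 ≤ ρ')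
    (hQ : Q.Finite)
    (H : ∀ k ∈ Q, ∃ m : Fin (n + 1) → ℤ, (∀ i, |k i - m i * spacing n σ R i| ≤ 2) ∧
      |m (Fin.last n) * R ^ (2 * σ) - t'| ≤ ρ' ∧
      ∀ j : Fin n, |m j.castSucc * R ^ σ - t (m (Fin.last n)) j| ≤ ρ) :
    (Q.ncard : ℝ) ≤
      5 ^ (n + 1) * ((2 * ρ / R ^ σ + 1) ^ n * (2 * ρ' / R ^ (2 * σ) + 1)) := by
  classical
  choose! f hf using H
  rw [Set.ncard_eq_toFinset_card Q hQ]
  -- Cubes assigned to the same lattice point have corners within `2` of it in each coordinate,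
  -- leaving at most `5` integers per coordinate.
  have h1 := Finset.card_le_mul_card_image (f := f) hQ.toFinset (5 ^ (n + 1)) (by
    intro a _
    refine card_le_of_near (fun i => a i * spacing n σ R i) fun k hk => ?_
    rw [Finset.mem_filter, Set.Finite.mem_toFinset] at hk
    rw [← hk.2]
    exact (hf k hk.1).1)
  have h2 : ((hQ.toFinset.image f).card : ℝ) ≤
      (2 * ρ / R ^ σ + 1) ^ n * (2 * ρ' / R ^ (2 * σ) + 1) := by
    refine card_le_of_shear t (t' := t') (by positivity) (by positivity) hρ hρ' ?_ ?_
    · intro m hm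
      obtain ⟨k, hk, rfl⟩ := Finset.mem_image.1 hm
      exact (hf k (hQ.mem_toFinset.1 hk)).2.1
    · intro m hm
      obtain ⟨k, hk, rfl⟩ := Finset.mem_image.1 hm
      exact (hf k (hQ.mem_toFinset.1 hk)).2.2
  calc (hQ.toFinset.card : ℝ) ≤ 5 ^ (n + 1) * ((hQ.toFinset.image f).card : ℝ) := by
        exact_mod_cast h1
    _ ≤ _ := by gcongr

theorem abs_coord_le_norm {m : ℕ} (x : EuclideanSpace ℝ (Fin m)) (i : Fin m) : |x i| ≤ ‖x‖ :=
  PiLp.norm_apply_le x i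

theorem finite_peakCubes (n : ℕ) (σ R : ℝ) : (peakCubes n σ R).Finite := by
  refine (Finset.finite_toSet (Fintype.piFinset fun _ => multiplesNear 1 0 R)).subset ?_
  intro k hk
  rw [Finset.mem_coe, Fintype.mem_piFinset]
  intro i
  rw [mem_multiplesNear one_pos, mul_one, sub_zero]
  have h1 : WithLp.toLp 2 (fun i => (k i : ℝ)) ∈ unitCube k := fun i => by simp
  have h2 := hk.1 h1
  rw [mem_ball_zero_iff] at h2
  exact (abs_coord_le_norm (WithLp.toLp 2 (fun i => (k i : ℝ))) i).trans h2.le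

theorem cubeUnion_peakCubes_subset (n : ℕ) (σ R : ℝ) :
    cubeUnion (peakCubes n σ R) ⊆ Metric.ball 0 R :=
  Set.iUnion₂_subset fun _ hk => hk.1

theorem abs_sub_le_of_mem_unitCube {m : ℕ} {k : Fin m → ℤ} {x : EuclideanSpace ℝ (Fin m)}
    (hx : x ∈ unitCube k) (i : Fin m) : |x i - k i| ≤ 1 := by
  rw [abs_le]
  constructor <;> linarith [(hx i).1, (hx i).2]

theorem exists_lattice_near {n : ℕ} {σ R : ℝ} {k : Fin (n + 1) → ℤ}
    (hk : k ∈ peakCubes n σ R) :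
    ∃ m : Fin (n + 1) → ℤ, (∀ i, |k i - m i * spacing n σ R i| ≤ 2) ∧
      ∀ i, |m i * spacing n σ R i| ≤ R := by
  obtain ⟨-, x, hxk, hx⟩ := hk
  obtain ⟨p, ⟨hp, hpR⟩, hxp⟩ := Metric.mem_thickening_iff.1 hx
  obtain ⟨m, hm⟩ := mem_peakLattice.1 hp
  refine ⟨m, fun i => ?_, fun i => ?_⟩
  · have h1 := abs_sub_le_of_mem_unitCube hxk i
    have h2 : |x i - p i| ≤ 1 := by
      rw [dist_eq_norm] at hxp
      exact (abs_coord_le_norm (x - p) i).trans hxp.le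
    rw [← hm i]
    rw [abs_le] at *
    constructor <;> linarith
  · rw [← hm i]
    rw [mem_ball_zero_iff] at hpR
    exact (abs_coord_le_norm p i).trans hpR.le

theorem volume_unitCube {m : ℕ} (k : Fin m → ℤ) : volume (unitCube k) = 1 := by
  have : unitCube k = {x : EuclideanSpace ℝ (Fin m) | ∀ i, x i ∈ Set.Ico (k i : ℝ) (k i + 1)} :=
    rfl
  rw [this, volume_coordBox]
  simp

theorem volume_cubeUnion_le {m : ℕ} {Q : Set (Fin m → ℤ)} (hQ : Q.Finite) :
    volume (cubeUnion Q) ≤ Q.ncard := by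
  have h1 : cubeUnion Q = ⋃ k ∈ hQ.toFinset, unitCube k := by simp [cubeUnion]
  rw [h1, Set.ncard_eq_toFinset_card Q hQ]
  refine (measure_biUnion_finset_le _ _).trans ?_
  simp [volume_unitCube]

theorem div_rpow_le {r R σ : ℝ} (hr : 1 ≤ r) (hrR : r ≤ R) (hσ : 0 ≤ σ) :
    r / R ^ σ ≤ r ^ (1 - σ) := by
  have hr0 : 0 < r := by linarith
  rw [Real.rpow_sub hr0, Real.rpow_one]
  gcongr

theorem pow_mul_rpow_eq {r σ a : ℝ} (hr : 0 < r) (n : ℕ) :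
    (a * r ^ (1 - σ)) ^ n * (a * r ^ (1 - 2 * σ)) =
      a ^ (n + 1) * r ^ ((n : ℝ) * (1 - σ) + (1 - 2 * σ)) := by
  rw [Real.rpow_add hr, mul_comm (n : ℝ), Real.rpow_mul_natCast hr.le]
  ring

theorem hasFractalStructure_peakCubes (n : ℕ) {σ R : ℝ} (hσ : 0 < σ) (hσ2 : σ < 1 / 2)
    (hR : 1 ≤ R) :
    HasFractalStructure (5 ^ (n + 1) * 9 ^ (n + 1)) ((n : ℝ) * (1 - σ) + (1 - 2 * σ)) R
      (cubeUnion (peakCubes n σ R)) := by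
  intro x r hr hrR _
  have hr0 : 0 < r := by linarith
  have hR0 : 0 < R := by linarith
  set Q := {k ∈ peakCubes n σ R | (unitCube k ∩ Metric.ball x r).Nonempty} with hQ
  have hfin : Q.Finite := (finite_peakCubes n σ R).subset (Set.sep_subset _ _)
  have hsub : Metric.ball x r ∩ cubeUnion (peakCubes n σ R) ⊆ cubeUnion Q := by
    rintro y ⟨hy, hyQ⟩
    obtain ⟨k, hk, hyk⟩ := Set.mem_iUnion₂.1 hyQ
    exact Set.mem_iUnion₂.2 ⟨k, ⟨hk, y, hyk, hy⟩, hyk⟩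
  refine (measure_mono hsub).trans ((volume_cubeUnion_le hfin).trans ?_)
  rw [← ENNReal.ofReal_natCast]
  refine ENNReal.ofReal_le_ofReal ?_
  have h1 : (Q.ncard : ℝ) ≤ 5 ^ (n + 1) * ((2 * (4 * r) / R ^ σ + 1) ^ n *
      (2 * (4 * r) / R ^ (2 * σ) + 1)) := by
    refine ncard_le_of_near_lattice (t' := x (Fin.last n)) hR0 (fun _ j => x j.castSucc)
      (by positivity) (by positivity) hfin ?_
    rintro k ⟨hk, y, hyk, hy⟩
    obtain ⟨m, hm, -⟩ := exists_lattice_near hk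
    -- Lattice point to cube corner, corner to `y`, `y` to `x`: `2 + 1 + r ≤ 4r`.
    have key : ∀ i, |m i * spacing n σ R i - x i| ≤ 4 * r := by
      intro i
      have h1 := abs_sub_le_of_mem_unitCube hyk i
      have h2 : |y i - x i| ≤ r := by
        rw [Metric.mem_ball, dist_eq_norm] at hy
        exact (abs_coord_le_norm (y - x) i).trans hy.le
      have h3 := hm i
      rw [abs_le] at *
      constructor <;> linarith
    refine ⟨m, hm, ?_, fun j => ?_⟩
    · simpa using key (Fin.last n)
    · simpa using key j.castSucc
  refine h1.trans ?_
  rw [mul_assoc, ← pow_mul_rpow_eq hr0]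
  -- Here `r ≤ R` turns the lattice spacing into powers of `r`, and `r ≥ 1` with `σ < 1/2` absorbs
  -- the `+ 1` terms, so `8 + 1 = 9`.
  have h2 := div_rpow_le hr hrR hσ.le
  have h3 := div_rpow_le hr hrR (by linarith : 0 ≤ 2 * σ)
  have h4 : 1 ≤ r ^ (1 - σ) := Real.one_le_rpow hr (by linarith)
  have h5 : 1 ≤ r ^ (1 - 2 * σ) := Real.one_le_rpow hr (by linarith)
  have h6 : 2 * (4 * r) / R ^ σ = 8 * (r / R ^ σ) := by ring
  have h7 : 2 * (4 * r) / R ^ (2 * σ) = 8 * (r / R ^ (2 * σ)) := by ring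
  gcongr <;> linarith

/-- At a fixed height the tube has width `O(K R^(1/2))` because its direction is `(-2ξ', 1)` with
`|ξ_j| ≤ 1`. The height range comes from `B_R`, which is why only `K^n` appears. -/
theorem ncard_tube_le (n : ℕ) {σ R : ℝ} (hσ : 0 < σ) (hσ2 : σ < 1 / 2) (hR : 1 ≤ R)
    {K : ℝ} (hK : 1 ≤ K) {ξ : EuclideanSpace ℝ (Fin n)} (hξ : ξ ∈ paramCube n)
    (a : EuclideanSpace ℝ (Fin (n + 1))) :
    ({k ∈ peakCubes n σ R | (unitCube k ∩ tube K R ξ a).Nonempty}.ncard : ℝ) ≤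
      5 ^ (n + 1) * 25 ^ (n + 1) * K ^ n * R ^ (-(n : ℝ) / 2) *
        R ^ ((n : ℝ) * (1 - σ) + (1 - 2 * σ)) := by
  have hR0 : 0 < R := by linarith
  set Q := {k ∈ peakCubes n σ R | (unitCube k ∩ tube K R ξ a).Nonempty} with hQ
  have hfin : Q.Finite := (finite_peakCubes n σ R).subset (Set.sep_subset _ _)
  set w₀ := K * R ^ (1 / 2 : ℝ) with hw₀
  have hw₀1 : 1 ≤ w₀ := one_le_mul_of_one_le_of_one_le hK (Real.one_le_rpow hR (by norm_num))
  have h1 : (Q.ncard : ℝ) ≤ 5 ^ (n + 1) * ((2 * (12 * w₀) / R ^ σ + 1) ^ n *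
      (2 * R / R ^ (2 * σ) + 1)) := by
    refine ncard_le_of_near_lattice (t' := 0) hR0
      (fun z j => a j.castSucc - 2 * ξ j * (z * R ^ (2 * σ) - a (Fin.last n)))
      (by positivity) hR0.le hfin ?_
    rintro k ⟨hk, y, hyk, -, hy⟩
    obtain ⟨m, hm, hmR⟩ := exists_lattice_near hk
    refine ⟨m, hm, by simpa using hmR (Fin.last n), fun j => ?_⟩
    -- The axis point is `a + s (-2ξ', 1)`. Replacing the unknown `s` by the lattice height costs
    -- `2(w₀ + 3)`, for a total of `3(w₀ + 3) ≤ 12 w₀`.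
    obtain ⟨s, hs⟩ := Submodule.mem_span_singleton.1
      (Submodule.starProjection_apply_mem (Submodule.span ℝ {normalVec ξ}) (y - a))
    rw [← hs] at hy
    have hwj := (abs_coord_le_norm _ j.castSucc).trans hy
    have hwl := (abs_coord_le_norm _ (Fin.last n)).trans hy
    simp only [normalVec, PiLp.sub_apply, PiLp.smul_apply, Fin.snoc_castSucc, Fin.snoc_last,
      smul_eq_mul, mul_one] at hwj hwl
    have hej := abs_sub_le_of_mem_unitCube hyk j.castSucc
    have hel := abs_sub_le_of_mem_unitCube hyk (Fin.last n)
    have hmj := hm j.castSucc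
    have hml := hm (Fin.last n)
    rw [spacing_castSucc] at hmj
    rw [spacing_last] at hml
    have hl : |(m (Fin.last n) * R ^ (2 * σ) - a (Fin.last n)) - s| ≤ w₀ + 3 := by
      rw [abs_le] at *
      constructor <;> linarith
    have hj : |m j.castSucc * R ^ σ - a j.castSucc + 2 * ξ j * s| ≤ w₀ + 3 := by
      rw [abs_le] at *
      constructor <;> linarith
    have hξl : |2 * ξ j * ((m (Fin.last n) * R ^ (2 * σ) - a (Fin.last n)) - s)| ≤
        2 * (w₀ + 3) := by
      rw [abs_mul, abs_mul, abs_two]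
      have := hξ j
      gcongr
      linarith
    have : m j.castSucc * R ^ σ -
        (a j.castSucc - 2 * ξ j * (m (Fin.last n) * R ^ (2 * σ) - a (Fin.last n))) =
        (m j.castSucc * R ^ σ - a j.castSucc + 2 * ξ j * s) +
        2 * ξ j * ((m (Fin.last n) * R ^ (2 * σ) - a (Fin.last n)) - s) := by ring
    rw [this]
    refine (abs_add_le _ _).trans ?_
    linarith
  refine h1.trans ?_
  have h2 : R ^ (-(n : ℝ) / 2) * R ^ ((n : ℝ) * (1 - σ) + (1 - 2 * σ)) =
      (R ^ (1 / 2 - σ)) ^ n * R ^ (1 - 2 * σ) := by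
    rw [← Real.rpow_mul_natCast hR0.le, ← Real.rpow_add hR0, ← Real.rpow_add hR0]
    ring_nf
  have h3 : 2 * (12 * w₀) / R ^ σ + 1 ≤ 25 * (K * R ^ (1 / 2 - σ)) := by
    have e : 2 * (12 * w₀) / R ^ σ = 24 * (K * R ^ (1 / 2 - σ)) := by
      rw [Real.rpow_sub hR0, hw₀]; ring
    have : 1 ≤ K * R ^ (1 / 2 - σ) :=
      one_le_mul_of_one_le_of_one_le hK (Real.one_le_rpow hR (by linarith))
    rw [e]; linarith
  have h4 : 2 * R / R ^ (2 * σ) + 1 ≤ 25 * R ^ (1 - 2 * σ) := by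
    have h5 := div_rpow_le hR le_rfl (by linarith : 0 ≤ 2 * σ)
    have h6 : 1 ≤ R ^ (1 - 2 * σ) := Real.one_le_rpow hR (by linarith)
    rw [mul_div_assoc]; linarith
  calc _ ≤ 5 ^ (n + 1) * ((25 * (K * R ^ (1 / 2 - σ))) ^ n * (25 * R ^ (1 - 2 * σ))) := by
        gcongr
    _ = 5 ^ (n + 1) * 25 ^ (n + 1) * K ^ n * ((R ^ (1 / 2 - σ)) ^ n * R ^ (1 - 2 * σ)) := by ring
    _ = _ := by rw [← h2]; ring

/-! ### Pointwise bounds for `g`: the trivial upper bound and coherence near lattice points. -/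

theorem ae_surfaceMeasure_mem (n : ℕ) : ∀ᵐ ξ ∂(surfaceMeasure n),
    (∀ j : Fin n, |ξ j.castSucc| ≤ 1) ∧ ξ (Fin.last n) = ∑ j : Fin n, ξ j.castSucc ^ 2 := by
  have hmeas : MeasurableSet {ξ : EuclideanSpace ℝ (Fin (n + 1)) |
      (∀ j : Fin n, |ξ j.castSucc| ≤ 1) ∧ ξ (Fin.last n) = ∑ j : Fin n, ξ j.castSucc ^ 2} := by
    have h1 : MeasurableSet {ξ : EuclideanSpace ℝ (Fin (n + 1)) |
        ∀ j : Fin n, |ξ j.castSucc| ≤ 1} := by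
      simp only [Set.ofPred_forall]
      exact MeasurableSet.iInter fun j =>
        (measurableSet_Iic (a := (1 : ℝ))).preimage
          (f := fun ξ : EuclideanSpace ℝ (Fin (n + 1)) => |ξ j.castSucc|) (by fun_prop)
    exact h1.inter (measurableSet_eq_fun (by fun_prop) (by fun_prop))
  rw [surfaceMeasure, ae_map_iff (measurable_graphPt n).aemeasurable hmeas]
  refine (withDensity_absolutelyContinuous _ _).ae_le ?_
  filter_upwards [ae_restrict_mem (measurableSet_paramCube n)] with ξ hξ
  refine ⟨fun j => by simpa using hξ j, ?_⟩
  simp [EuclideanSpace.norm_sq_eq]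

theorem integrable_h (n : ℕ) {σ R : ℝ} (hσ : 0 < σ) (hR : 1 < R) :
    Integrable (h n σ R) (surfaceMeasure n) :=
  ⟨(measurable_h n σ R).aestronglyMeasurable,
    (lintegral_enorm_h_le n hσ hR).trans_lt ENNReal.ofReal_lt_top⟩

theorem le_integral_norm_h (n : ℕ) {σ R : ℝ} (hσ : 0 < σ) (hR : 1 < R) :
    (1 / 2) ^ n * R ^ ((n : ℝ) * (σ - 1)) ≤ ∫ ξ, ‖h n σ R ξ‖ ∂(surfaceMeasure n) := by
  rw [integral_norm_eq_lintegral_enorm (measurable_h n σ R).aestronglyMeasurable]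
  exact (ENNReal.ofReal_le_iff_le_toReal (integrable_h n hσ hR).2.ne).1
    (le_lintegral_enorm_h n hσ hR)

theorem integral_norm_h_le (n : ℕ) {σ R : ℝ} (hσ : 0 < σ) (hR : 1 < R) :
    ∫ ξ, ‖h n σ R ξ‖ ∂(surfaceMeasure n) ≤
      (1 + 4 * n) * 2 ^ n * R ^ ((n : ℝ) * (σ - 1)) := by
  rw [integral_norm_eq_lintegral_enorm (measurable_h n σ R).aestronglyMeasurable]
  exact ENNReal.toReal_le_of_le_ofReal (by positivity) (lintegral_enorm_h_le n hσ hR)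

theorem norm_exp_phase (t : ℝ) : ‖Complex.exp (2 * Real.pi * Complex.I * (t : ℝ))‖ = 1 := by
  rw [show 2 * (Real.pi : ℂ) * Complex.I * (t : ℂ) = ((2 * Real.pi * t : ℝ) : ℂ) * Complex.I by
    push_cast; ring]
  exact Complex.norm_exp_ofReal_mul_I _

theorem re_exp_phase (t : ℝ) :
    (Complex.exp (2 * Real.pi * Complex.I * (t : ℝ))).re = Real.cos (2 * Real.pi * t) := by
  rw [show 2 * (Real.pi : ℂ) * Complex.I * (t : ℂ) = ((2 * Real.pi * t : ℝ) : ℂ) * Complex.I by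
    push_cast; ring]
  exact Complex.exp_ofReal_mul_I_re _

theorem norm_g_le (n : ℕ) {σ R : ℝ} (hσ : 0 < σ) (hR : 1 < R)
    (x : EuclideanSpace ℝ (Fin (n + 1))) :
    ‖g n σ R x‖ ≤ (1 + 4 * n) * 2 ^ n * R ^ ((n : ℝ) * (σ - 1)) := by
  refine le_trans ?_ (integral_norm_h_le n hσ hR)
  refine (norm_integral_le_integral_norm _).trans_eq ?_
  simp_rw [norm_mul, norm_exp_phase, mul_one]

/-- If the phase is within `1 / 6` of an integer on the support of `h dω`, there is no
cancellation in `g`. -/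
theorem le_norm_g_of_phase (n : ℕ) {σ R : ℝ} (hσ : 0 < σ) (hR : 1 < R)
    (x : EuclideanSpace ℝ (Fin (n + 1)))
    (hx : ∀ ξ : EuclideanSpace ℝ (Fin (n + 1)), (∀ j : Fin n, |ξ j.castSucc| ≤ 1) →
      ξ (Fin.last n) = ∑ j : Fin n, ξ j.castSucc ^ 2 →
      (∃ l ∈ boxIndices n σ R, ξ ∈ freqBox σ R l) → 1 / 2 ≤ Real.cos (2 * Real.pi * inner ℝ x ξ)) :
    (1 / 2) ^ (n + 1) * R ^ ((n : ℝ) * (σ - 1)) ≤ ‖g n σ R x‖ := by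
  classical
  have hint := integrable_h n hσ hR
  have hmeas : Measurable fun ξ : EuclideanSpace ℝ (Fin (n + 1)) =>
      h n σ R ξ * Complex.exp (2 * Real.pi * Complex.I * (inner ℝ x ξ : ℝ)) := by
    refine (measurable_h n σ R).mul ?_
    fun_prop
  have hint' : Integrable (fun ξ => h n σ R ξ *
      Complex.exp (2 * Real.pi * Complex.I * (inner ℝ x ξ : ℝ))) (surfaceMeasure n) := by
    refine hint.mono hmeas.aestronglyMeasurable (Filter.Eventually.of_forall fun ξ => ?_)
    rw [norm_mul, norm_exp_phase, mul_one]
  refine le_trans ?_ (Complex.re_le_norm _)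
  have hre : (g n σ R x).re = ∫ ξ, (h n σ R ξ *
      Complex.exp (2 * Real.pi * Complex.I * (inner ℝ x ξ : ℝ))).re ∂(surfaceMeasure n) :=
    (integral_re hint').symm
  rw [hre]
  have h1 := le_integral_norm_h n hσ hR
  calc _ ≤ (1 / 2) * ∫ ξ, ‖h n σ R ξ‖ ∂(surfaceMeasure n) := by rw [pow_succ]; linarith
    _ = ∫ ξ, (1 / 2) * ‖h n σ R ξ‖ ∂(surfaceMeasure n) := (integral_const_mul _ _).symm
    _ ≤ _ := by
      refine integral_mono_ae (hint.norm.const_mul _) hint'.re ?_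
      filter_upwards [ae_surfaceMeasure_mem n] with ξ hξ
      change 1 / 2 * ‖h n σ R ξ‖ ≤ (h n σ R ξ *
        Complex.exp (2 * Real.pi * Complex.I * (inner ℝ x ξ : ℝ))).re
      rw [h_eq_boxCount, ← Complex.ofReal_natCast, Complex.re_ofReal_mul, re_exp_phase,
        Complex.norm_real, Real.norm_natCast, mul_comm]
      rcases Nat.eq_zero_or_pos (boxCount n σ R ξ) with h0 | hpos
      · simp [h0]
      · obtain ⟨l, hl⟩ := Finset.card_pos.1 hpos
        have hl' := Finset.mem_filter.1 hl
        have := hx ξ hξ.1 hξ.2 ⟨l, hl'.1, hl'.2⟩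
        gcongr

theorem half_le_cos_of_near_int {y : ℝ} {N : ℤ} (hy : |y - N| ≤ 1 / 6) :
    1 / 2 ≤ Real.cos (2 * Real.pi * y) := by
  have h1 : Real.cos (2 * Real.pi * y) = Real.cos |2 * Real.pi * (y - N)| := by
    rw [Real.cos_abs, ← Real.cos_sub_int_mul_two_pi (2 * Real.pi * y) N]
    ring_nf
  rw [h1, ← Real.cos_pi_div_three]
  have hpi := Real.pi_pos
  refine Real.cos_le_cos_of_nonneg_of_le_pi (abs_nonneg _) (by linarith) ?_
  rw [abs_mul, abs_of_pos (by positivity)]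
  nlinarith

/-- Replace `x`, `x_d`, `ξ` and `ξ²` by their lattice values in turn; the errors are `δ`, `δ`, `δR ·
R⁻¹` and `δR · 2R⁻¹`. -/
theorem abs_phase_coord_le {S R δ x xd ξ : ℝ} {m md l : ℤ} (hS : 0 < S) (hR : 0 < R)
    (hx : |x - m * S| ≤ δ) (hxd : |xd - md * S ^ 2| ≤ δ) (hm : |m * S| ≤ δ * R)
    (hmd : |md * S ^ 2| ≤ δ * R) (hξ : |ξ| ≤ 1) (hl : |l * S⁻¹| ≤ 1)
    (hξl : |ξ - l * S⁻¹| ≤ R⁻¹) :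
    |x * ξ + xd * ξ ^ 2 - ((m * l + md * l ^ 2 : ℤ) : ℝ)| ≤ 5 * δ := by
  have hδ : 0 ≤ δ := (abs_nonneg _).trans hx
  have e : x * ξ + xd * ξ ^ 2 - ((m * l + md * l ^ 2 : ℤ) : ℝ) =
      (x - m * S) * ξ + (xd - md * S ^ 2) * ξ ^ 2 + m * S * (ξ - l * S⁻¹) +
        md * S ^ 2 * ((ξ - l * S⁻¹) * (ξ + l * S⁻¹)) := by
    push_cast; field_simp; ring
  have h1 : |(x - m * S) * ξ| ≤ δ := by
    rw [abs_mul]; exact (mul_le_of_le_one_right (abs_nonneg _) hξ).trans hx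
  have h2 : |(xd - md * S ^ 2) * ξ ^ 2| ≤ δ := by
    rw [abs_mul, abs_pow]
    exact (mul_le_of_le_one_right (abs_nonneg _) (pow_le_one₀ (abs_nonneg _) hξ)).trans hxd
  have hδR : δ * R * R⁻¹ = δ := by field_simp
  have h3 : |m * S * (ξ - l * S⁻¹)| ≤ δ := by
    rw [abs_mul]
    calc _ ≤ δ * R * R⁻¹ := by gcongr
      _ = δ := hδR
  have h4 : |md * S ^ 2 * ((ξ - l * S⁻¹) * (ξ + l * S⁻¹))| ≤ 2 * δ := by
    rw [abs_mul, abs_mul (ξ - _)]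
    have h5 : |ξ + l * S⁻¹| ≤ 2 := (abs_add_le _ _).trans (by linarith)
    calc _ ≤ δ * R * (R⁻¹ * 2) := by gcongr
      _ = 2 * δ := by rw [← mul_assoc, hδR, mul_comm]
  rw [e]
  refine (abs_add_le _ _).trans ?_
  have h6 := abs_add_le ((x - m * S) * ξ + (xd - md * S ^ 2) * ξ ^ 2) (m * S * (ξ - l * S⁻¹))
  have h7 := abs_add_le ((x - m * S) * ξ) ((xd - md * S ^ 2) * ξ ^ 2)
  linarith

/-- The scale at which the phases of `g` stay coherent. -/
def cohScale (n : ℕ) : ℝ := 1 / (30 * (n + 1))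

theorem cohScale_pos (n : ℕ) : 0 < cohScale n := by unfold cohScale; positivity

theorem cohScale_mul (n : ℕ) : 30 * ((n : ℝ) + 1) * cohScale n = 1 := by
  unfold cohScale; field_simp

theorem cohScale_le (n : ℕ) : cohScale n ≤ 1 / 30 := by
  have h1 := cohScale_mul n
  have h2 := cohScale_pos n
  nlinarith [(Nat.cast_nonneg n : (0 : ℝ) ≤ n)]

theorem le_norm_g_of_near (n : ℕ) {σ R : ℝ} (hσ : 0 < σ) (hR : 1 < R)
    {m : Fin (n + 1) → ℤ} (hm : ∀ i, |m i * spacing n σ R i| ≤ cohScale n * R)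
    {x : EuclideanSpace ℝ (Fin (n + 1))}
    (hx : ∀ i, |x i - m i * spacing n σ R i| ≤ cohScale n) :
    (1 / 2) ^ (n + 1) * R ^ ((n : ℝ) * (σ - 1)) ≤ ‖g n σ R x‖ := by
  have hR0 : 0 < R := by linarith
  refine le_norm_g_of_phase n hσ hR x fun ξ hξ1 hξ2 ⟨l, hl, hξl⟩ => ?_
  refine half_le_cos_of_near_int
    (N := ∑ j : Fin n, (m j.castSucc * l j + m (Fin.last n) * l j ^ 2)) ?_
  have hS : 0 < R ^ σ := by positivity
  have hS2 : R ^ (2 * σ) = (R ^ σ) ^ 2 := by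
    rw [mul_comm, ← Real.rpow_mul_natCast hR0.le]; norm_num
  have hinner : inner ℝ x ξ =
      ∑ j : Fin n, (x j.castSucc * ξ j.castSucc + x (Fin.last n) * ξ j.castSucc ^ 2) := by
    rw [Finset.sum_add_distrib, ← Finset.mul_sum, ← hξ2, PiLp.inner_apply,
      Fin.sum_univ_castSucc]
    simp [mul_comm]
  rw [hinner, Int.cast_sum, ← Finset.sum_sub_distrib]
  refine (Finset.abs_sum_le_sum_abs _ _).trans ?_
  have hxl := hx (Fin.last n)
  have hml := hm (Fin.last n)
  rw [spacing_last, hS2] at hxl hml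
  calc _ ≤ ∑ _j : Fin n, 5 * cohScale n := by
        refine Finset.sum_le_sum fun j _ => ?_
        have hxj := hx j.castSucc
        have hmj := hm j.castSucc
        rw [spacing_castSucc] at hxj hmj
        have hlj := mem_boxIndices.1 hl j
        have hlj1 : (1 : ℝ) ≤ l j := by exact_mod_cast hlj.1
        have hb := hξl j
        rw [Real.rpow_neg hR0.le] at hb
        refine abs_phase_coord_le hS hR0 hxj hxl hmj hml (hξ1 j) ?_ ?_
        · rw [abs_of_nonneg (by positivity), ← div_eq_mul_inv, div_le_one hS]
          exact hlj.2.le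
        · rw [abs_le]
          exact ⟨by linarith [hb.1], by linarith [hb.2]⟩
    _ = n * (5 * cohScale n) := by simp
    -- This fixes the constant in `cohScale`: `n · 5 / (30(n + 1)) ≤ 1/6`.
    _ ≤ 1 / 6 := by
        have h1 := cohScale_mul n
        have h2 := cohScale_pos n
        linarith

/-! ### Disjoint boxes inside `Y` on which `g` is large, and the lower bound for the number of
cubes. -/

/-- The lower end of an interval of length `δ` that has `p` as an end point and stays in the unit
interval `[⌊p⌋, ⌊p⌋ + 1)`. -/
def boxCorner (δ p : ℝ) : ℝ := if p + δ ≤ ⌊p⌋ + 1 then p else p - δ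

theorem boxCorner_spec {δ : ℝ} (hδ : 0 ≤ δ) (hδ2 : δ ≤ 1 / 2) (p : ℝ) :
    (⌊p⌋ : ℝ) ≤ boxCorner δ p ∧ boxCorner δ p + δ ≤ ⌊p⌋ + 1 ∧ p - δ ≤ boxCorner δ p ∧
      boxCorner δ p ≤ p := by
  have h1 := Int.floor_le p
  have h2 := Int.lt_floor_add_one p
  unfold boxCorner
  split_ifs with h
  · exact ⟨h1, h, by linarith, le_rfl⟩
  · push Not at h
    exact ⟨by linarith, by linarith, le_rfl, by linarith⟩

/-- A box of side `cohScale n` at the lattice point with index `m`, inside one unit cube. -/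
def peakBox (n : ℕ) (σ R : ℝ) (m : Fin (n + 1) → ℤ) : Set (EuclideanSpace ℝ (Fin (n + 1))) :=
  {x | ∀ i, x i ∈ Set.Ico (boxCorner (cohScale n) (m i * spacing n σ R i))
    (boxCorner (cohScale n) (m i * spacing n σ R i) + cohScale n)}

theorem volume_peakBox (n : ℕ) (σ R : ℝ) (m : Fin (n + 1) → ℤ) :
    volume (peakBox n σ R m) = ENNReal.ofReal (cohScale n ^ (n + 1)) := by
  rw [peakBox, volume_coordBox, ENNReal.ofReal_pow (cohScale_pos n).le]
  simp

theorem measurableSet_peakBox (n : ℕ) (σ R : ℝ) (m : Fin (n + 1) → ℤ) :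
    MeasurableSet (peakBox n σ R m) := by
  simp only [peakBox, Set.ofPred_forall]
  exact MeasurableSet.iInter fun i => measurableSet_Ico.preimage (by fun_prop)

theorem abs_sub_le_of_mem_peakBox {n : ℕ} {σ R : ℝ} {m : Fin (n + 1) → ℤ}
    {x : EuclideanSpace ℝ (Fin (n + 1))} (hx : x ∈ peakBox n σ R m) (i : Fin (n + 1)) :
    |x i - m i * spacing n σ R i| ≤ cohScale n := by
  have h1 := boxCorner_spec (cohScale_pos n).le ((cohScale_le n).trans (by norm_num))
    (m i * spacing n σ R i)
  have h2 := hx i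
  rw [abs_le]
  exact ⟨by linarith [h2.1], by linarith [h2.2]⟩

theorem peakBox_subset_unitCube (n : ℕ) (σ R : ℝ) (m : Fin (n + 1) → ℤ) :
    peakBox n σ R m ⊆ unitCube fun i => ⌊m i * spacing n σ R i⌋ := by
  intro x hx i
  have h1 := boxCorner_spec (cohScale_pos n).le ((cohScale_le n).trans (by norm_num))
    (m i * spacing n σ R i)
  have h2 := hx i
  exact ⟨by linarith [h2.1], by linarith [h2.2]⟩

theorem disjoint_peakBox {n : ℕ} {σ R : ℝ} (hσ : 0 ≤ σ) (hR : 1 ≤ R) {m m' : Fin (n + 1) → ℤ}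
    (hmm : m ≠ m') : Disjoint (peakBox n σ R m) (peakBox n σ R m') := by
  obtain ⟨i, hi⟩ := Function.ne_iff.1 hmm
  rw [Set.disjoint_left]
  intro x hx hx'
  have h1 := abs_sub_le_of_mem_peakBox hx i
  have h2 := abs_sub_le_of_mem_peakBox hx' i
  have h3 := one_le_spacing n hσ hR i
  have h4 : (1 : ℝ) ≤ |(m i : ℝ) - m' i| := by
    have : (1 : ℤ) ≤ |m i - m' i| := Int.one_le_abs (sub_ne_zero.2 hi)
    exact_mod_cast this
  have h5 : 1 ≤ |(m i : ℝ) * spacing n σ R i - m' i * spacing n σ R i| := by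
    rw [← sub_mul, abs_mul, abs_of_nonneg (by linarith : 0 ≤ spacing n σ R i)]
    exact one_le_mul_of_one_le_of_one_le h4 h3
  have h6 := abs_sub_le ((m i : ℝ) * spacing n σ R i) (x i) (m' i * spacing n σ R i)
  rw [abs_sub_comm] at h1
  linarith [cohScale_le n]

/-- The indices of the lattice points around which `g` is shown to be large. -/
def peakIndices (n : ℕ) (σ R : ℝ) : Finset (Fin (n + 1) → ℤ) :=
  Fintype.piFinset fun i => multiplesNear (spacing n σ R i) 0 (cohScale n * R)

theorem abs_le_of_mem_peakIndices {n : ℕ} {σ R : ℝ} (hσ : 0 ≤ σ) (hR : 1 ≤ R)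
    {m : Fin (n + 1) → ℤ} (hm : m ∈ peakIndices n σ R) (i : Fin (n + 1)) :
    |m i * spacing n σ R i| ≤ cohScale n * R := by
  have h1 := Fintype.mem_piFinset.1 hm i
  rw [mem_multiplesNear (by linarith [one_le_spacing n hσ hR i]), sub_zero] at h1
  exact h1

theorem le_card_multiplesNear {s ρ : ℝ} (hs : 0 < s) (hρ : 0 ≤ ρ) :
    ρ / s ≤ ((multiplesNear s 0 ρ).card : ℝ) := by
  rw [multiplesNear, Int.card_Icc]
  have h1 : ⌈(0 - ρ) / s⌉ ≤ 0 := by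
    rw [Int.ceil_le, div_le_iff₀ hs]; simpa using hρ
  have h2 : (⌊(0 + ρ) / s⌋ + 1 : ℤ) ≤ ((⌊(0 + ρ) / s⌋ + 1 - ⌈(0 - ρ) / s⌉).toNat : ℤ) := by
    refine le_trans ?_ (Int.self_le_toNat _)
    omega
  have h3 : ((⌊(0 + ρ) / s⌋ : ℝ) + 1) ≤
      ((⌊(0 + ρ) / s⌋ + 1 - ⌈(0 - ρ) / s⌉).toNat : ℝ) := by exact_mod_cast h2
  refine le_trans ?_ h3
  rw [zero_add]
  exact (Int.lt_floor_add_one _).le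

theorem le_card_peakIndices (n : ℕ) {σ R : ℝ} (hσ : 0 ≤ σ) (hR : 1 ≤ R) :
    cohScale n ^ (n + 1) * R ^ ((n : ℝ) * (1 - σ) + (1 - 2 * σ)) ≤
      ((peakIndices n σ R).card : ℝ) := by
  have hR0 : 0 < R := by linarith
  have hδ := cohScale_pos n
  have hs : ∀ i, 0 < spacing n σ R i := fun i => by linarith [one_le_spacing n hσ hR i]
  rw [peakIndices, Fintype.card_piFinset]
  push_cast
  calc _ = ∏ i, (cohScale n * R / spacing n σ R i) := by
        rw [Fin.prod_univ_castSucc, ← pow_mul_rpow_eq hR0, Real.rpow_sub hR0, Real.rpow_sub hR0]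
        simp [mul_div_assoc]
    _ ≤ _ := Finset.prod_le_prod (fun i _ => div_nonneg (by positivity) (hs i).le)
        fun i _ => le_card_multiplesNear (hs i) (by positivity)

theorem norm_lt_of_forall_abs_lt {m : ℕ} (hm : 0 < m) {x : EuclideanSpace ℝ (Fin m)} {b : ℝ}
    (hx : ∀ i, |x i| < b) : ‖x‖ < √m * b := by
  have hb : 0 ≤ b := (abs_nonneg _).trans (hx ⟨0, hm⟩).le
  rw [EuclideanSpace.norm_eq, ← Real.sqrt_sq hb, ← Real.sqrt_mul (Nat.cast_nonneg m)]
  refine Real.sqrt_lt_sqrt (by positivity) ?_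
  have : Nonempty (Fin m) := ⟨⟨0, hm⟩⟩
  calc ∑ i, ‖x i‖ ^ 2 < ∑ _i : Fin m, b ^ 2 :=
        Finset.sum_lt_sum_of_nonempty Finset.univ_nonempty fun i _ =>
          pow_lt_pow_left₀ (hx i) (abs_nonneg _) two_ne_zero
    _ = m * b ^ 2 := by simp

/-- The cube around a central lattice point lies in `B_R`, so the box inside it belongs to `Y`. -/
theorem floor_mem_peakCubes (n : ℕ) {σ R : ℝ} (hσ : 0 ≤ σ) (hR : √((n + 1 : ℕ) : ℝ) ≤ R)
    {m : Fin (n + 1) → ℤ} (hm : m ∈ peakIndices n σ R) :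
    (fun i => ⌊m i * spacing n σ R i⌋) ∈ peakCubes n σ R := by
  have hsq1 : 1 ≤ √((n + 1 : ℕ) : ℝ) := by rw [Real.one_le_sqrt]; simp
  have hR1 : 1 ≤ R := hsq1.trans hR
  have hδ := cohScale_pos n
  have hδ' := cohScale_le n
  have hmi := abs_le_of_mem_peakIndices hσ hR1 hm
  have hsq : √((n + 1 : ℕ) : ℝ) ≤ n + 1 := by
    rw [Real.sqrt_le_left (by positivity)]
    push_cast
    nlinarith [(Nat.cast_nonneg n : (0 : ℝ) ≤ n)]
  have hδR : (n + 1) * (cohScale n * R) = R / 30 := by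
    have := cohScale_mul n
    linear_combination (R / 30) * this
  set p : EuclideanSpace ℝ (Fin (n + 1)) := WithLp.toLp 2 fun i => m i * spacing n σ R i with hp
  have hpi : ∀ i, p i = m i * spacing n σ R i := fun i => rfl
  have hpQ : p ∈ unitCube fun i => ⌊m i * spacing n σ R i⌋ := fun i =>
    ⟨Int.floor_le _, Int.lt_floor_add_one _⟩
  have hsub : (unitCube fun i => ⌊m i * spacing n σ R i⌋) ⊆ Metric.ball 0 R := by
    intro x hx
    rw [mem_ball_zero_iff]
    by_cases hbig : 1 ≤ cohScale n * R
    · have hx' : ∀ i, |x i| < 4 * (cohScale n * R) := fun i => by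
        have h1 := abs_sub_le_of_mem_unitCube hx i
        have h2 := abs_sub_le_of_mem_unitCube hpQ i
        have h3 := hmi i
        rw [hpi] at h2
        rw [abs_le] at h1 h2 h3
        rw [abs_lt]
        constructor <;> linarith
      have := norm_lt_of_forall_abs_lt n.succ_pos hx'
      refine this.trans_le ?_
      calc _ ≤ ((n : ℝ) + 1) * (4 * (cohScale n * R)) := by gcongr
        _ = 4 * (R / 30) := by rw [← hδR]; ring
        _ ≤ R := by linarith
    -- For small `R` only the origin remains, with cube `[0,1)^d`; it lies in the open ball exactly
    -- because `R ≥ √d`.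
    · push Not at hbig
      have hm0 : ∀ i, m i = 0 := fun i => by
        by_contra hne
        have h1 : (1 : ℝ) ≤ |(m i : ℝ)| := by exact_mod_cast Int.one_le_abs hne
        have h2 := one_le_spacing n hσ hR1 i
        have h3 := hmi i
        rw [abs_mul, abs_of_nonneg (by linarith : 0 ≤ spacing n σ R i)] at h3
        linarith [one_le_mul_of_one_le_of_one_le h1 h2]
      have hx' : ∀ i, |x i| < 1 := fun i => by
        have := hx i
        simp only [hm0, Int.cast_zero, zero_mul, Int.floor_zero, zero_add] at this
        rw [abs_lt]
        exact ⟨by linarith [this.1], this.2⟩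
      have := norm_lt_of_forall_abs_lt n.succ_pos hx'
      rw [mul_one] at this
      exact this.trans_le hR
  exact ⟨hsub, p, hpQ, Metric.self_subset_thickening one_pos _
    ⟨mem_peakLattice.2 ⟨m, hpi⟩, hsub hpQ⟩⟩

/-- The union of the boxes around the peaks. -/
def peakSet (n : ℕ) (σ R : ℝ) : Set (EuclideanSpace ℝ (Fin (n + 1))) :=
  ⋃ m ∈ peakIndices n σ R, peakBox n σ R m

theorem peakSet_subset (n : ℕ) {σ R : ℝ} (hσ : 0 ≤ σ) (hR : √((n + 1 : ℕ) : ℝ) ≤ R) :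
    peakSet n σ R ⊆ cubeUnion (peakCubes n σ R) :=
  Set.iUnion₂_subset fun m hm => (peakBox_subset_unitCube n σ R m).trans
    (Set.subset_biUnion_of_mem (u := fun k => unitCube k) (floor_mem_peakCubes n hσ hR hm))

theorem measurableSet_peakSet (n : ℕ) (σ R : ℝ) : MeasurableSet (peakSet n σ R) :=
  Finset.measurableSet_biUnion _ fun m _ => measurableSet_peakBox n σ R m

theorem le_volume_peakSet (n : ℕ) {σ R : ℝ} (hσ : 0 ≤ σ) (hR : 1 ≤ R) :
    ENNReal.ofReal ((cohScale n ^ (n + 1)) ^ 2 * R ^ ((n : ℝ) * (1 - σ) + (1 - 2 * σ))) ≤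
      volume (peakSet n σ R) := by
  rw [peakSet, measure_biUnion_finset (fun m _ m' _ hmm => disjoint_peakBox hσ hR hmm)
    fun m _ => measurableSet_peakBox n σ R m]
  simp only [volume_peakBox, Finset.sum_const, nsmul_eq_mul]
  have hδ := cohScale_pos n
  rw [← ENNReal.ofReal_natCast, ← ENNReal.ofReal_mul (by positivity)]
  refine ENNReal.ofReal_le_ofReal ?_
  have := mul_le_mul_of_nonneg_right (le_card_peakIndices n hσ hR)
    (by positivity : 0 ≤ cohScale n ^ (n + 1))
  linarith

theorem le_ncard_peakCubes (n : ℕ) {σ R : ℝ} (hσ : 0 ≤ σ) (hR : √((n + 1 : ℕ) : ℝ) ≤ R)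
    (hR1 : 1 ≤ R) :
    (cohScale n ^ (n + 1)) ^ 2 * R ^ ((n : ℝ) * (1 - σ) + (1 - 2 * σ)) ≤
      ((peakCubes n σ R).ncard : ℝ) := by
  have h1 := (le_volume_peakSet n hσ hR1).trans ((measure_mono (peakSet_subset n hσ hR)).trans
    (volume_cubeUnion_le (finite_peakCubes n σ R)))
  rw [← ENNReal.ofReal_natCast] at h1
  exact (ENNReal.ofReal_le_ofReal_iff (by positivity)).1 h1

theorem tubesHitSmallFraction_peakCubes (n : ℕ) {σ R : ℝ} (hσ : 0 < σ) (hσ2 : σ < 1 / 2)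
    (hR : √((n + 1 : ℕ) : ℝ) ≤ R) (hR1 : 1 ≤ R) :
    TubesHitSmallFraction (5 ^ (n + 1) * 25 ^ (n + 1) * ((cohScale n ^ (n + 1)) ^ 2)⁻¹) R
      (peakCubes n σ R) := by
  intro K hK ξ hξ a
  have hδ := cohScale_pos n
  have hR0 : 0 < R := by linarith
  refine (ncard_tube_le n hσ hσ2 hR1 hK hξ a).trans ?_
  have h1 := le_ncard_peakCubes n hσ.le hR hR1
  rw [← le_inv_mul_iff₀ (by positivity)] at h1
  calc _ ≤ 5 ^ (n + 1) * 25 ^ (n + 1) * K ^ n * R ^ (-(n : ℝ) / 2) *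
        (((cohScale n ^ (n + 1)) ^ 2)⁻¹ * ((peakCubes n σ R).ncard : ℝ)) := by gcongr
    _ = _ := by ring

/-! ### The `L²` norm of `g` on `Y`, and the final comparison of powers. -/

theorem le_eLpNorm_g (n : ℕ) {σ R : ℝ} (hσ : 0 < σ) (hR : √((n + 1 : ℕ) : ℝ) ≤ R)
    (hR1 : 1 < R) :
    ENNReal.ofReal ((1 / 2) ^ (n + 1) * cohScale n ^ (n + 1) *
      R ^ ((n : ℝ) * (σ - 1) + ((n : ℝ) * (1 - σ) + (1 - 2 * σ)) / 2)) ≤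
      eLpNorm (g n σ R) 2 (volume.restrict (cubeUnion (peakCubes n σ R))) := by
  have hR0 : 0 < R := by linarith
  have hδ := cohScale_pos n
  set b : ℝ := (1 / 2) ^ (n + 1) * R ^ ((n : ℝ) * (σ - 1)) with hb
  have hb0 : 0 ≤ b := by positivity
  have h1 : eLpNorm (fun _ : EuclideanSpace ℝ (Fin (n + 1)) => b) 2
      (volume.restrict (peakSet n σ R)) ≤
      eLpNorm (g n σ R) 2 (volume.restrict (cubeUnion (peakCubes n σ R))) := by
    refine le_trans ?_ (eLpNorm_mono_measure _
      (Measure.restrict_mono (peakSet_subset n hσ.le hR) le_rfl))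
    refine eLpNorm_mono_ae ?_
    filter_upwards [ae_restrict_mem (measurableSet_peakSet n σ R)] with x hx
    obtain ⟨m, hm, hxm⟩ := Set.mem_iUnion₂.1 hx
    rw [Real.norm_of_nonneg hb0]
    exact le_norm_g_of_near n hσ hR1 (abs_le_of_mem_peakIndices hσ.le hR1.le hm)
      (abs_sub_le_of_mem_peakBox hxm)
  refine le_trans ?_ h1
  rw [eLpNorm_const' _ (by simp) (by simp), Measure.restrict_apply_univ,
    Real.enorm_of_nonneg hb0]
  have h2 := ENNReal.rpow_le_rpow (le_volume_peakSet n hσ.le hR1.le)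
    (by norm_num : (0 : ℝ) ≤ 1 / 2)
  rw [ofReal_rpow_half (by positivity) hR0.le, Real.sqrt_sq (by positivity)] at h2
  calc _ = ENNReal.ofReal b * ENNReal.ofReal (cohScale n ^ (n + 1) *
        R ^ (((n : ℝ) * (1 - σ) + (1 - 2 * σ)) / 2)) := by
        rw [← ENNReal.ofReal_mul hb0, hb, Real.rpow_add hR0]
        congr 1; ring
    _ ≤ _ := by
        gcongr
        simpa using h2

theorem eLpNorm_g_le (n : ℕ) {σ R : ℝ} (hσ : 0 < σ) (hσ2 : σ < 1 / 2) (hR1 : 1 < R) :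
    eLpNorm (g n σ R) 2 (volume.restrict (cubeUnion (peakCubes n σ R))) ≤
      ENNReal.ofReal ((1 + 4 * n) * 2 ^ n * √(5 ^ (n + 1) * 9 ^ (n + 1)) *
        R ^ ((n : ℝ) * (σ - 1) + ((n : ℝ) * (1 - σ) + (1 - 2 * σ)) / 2)) := by
  have hR0 : 0 < R := by linarith
  refine (eLpNorm_le_of_ae_bound (Filter.Eventually.of_forall (norm_g_le n hσ hR1))).trans ?_
  rw [Measure.restrict_apply_univ]
  -- The fractal bound at the top scale `r = R` gives `|Y| ≲ R^α`.
  have h1 := hasFractalStructure_peakCubes n hσ hσ2 hR1.le 0 R hR1.le le_rfl le_rfl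
  rw [Set.inter_eq_right.2 (cubeUnion_peakCubes_subset n σ R)] at h1
  have h2 := ENNReal.rpow_le_rpow h1 (by norm_num : (0 : ℝ) ≤ 1 / 2)
  rw [ofReal_rpow_half (by positivity) hR0.le] at h2
  calc _ ≤ ENNReal.ofReal (√(5 ^ (n + 1) * 9 ^ (n + 1)) *
        R ^ (((n : ℝ) * (1 - σ) + (1 - 2 * σ)) / 2)) *
        ENNReal.ofReal ((1 + 4 * n) * 2 ^ n * R ^ ((n : ℝ) * (σ - 1))) := by
        gcongr
        simpa using h2
    _ = _ := by
        rw [← ENNReal.ofReal_mul (by positivity), Real.rpow_add hR0]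
        congr 1; ring

theorem HasFractalStructure.mono {m : ℕ} {A B α R : ℝ} {Y : Set (EuclideanSpace ℝ (Fin m))}
    (hY : HasFractalStructure A α R Y) (hAB : A ≤ B) : HasFractalStructure B α R Y := by
  intro x r hr hrR hsub
  refine (hY x r hr hrR hsub).trans (ENNReal.ofReal_le_ofReal ?_)
  have : 0 ≤ r ^ α := Real.rpow_nonneg (by linarith) _
  gcongr

theorem TubesHitSmallFraction.mono {n : ℕ} {A B R : ℝ} {Q : Set (Fin (n + 1) → ℤ)}
    (hQ : TubesHitSmallFraction A R Q) (hAB : A ≤ B) (hR : 0 ≤ R) :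
    TubesHitSmallFraction B R Q := by
  intro K hK ξ hξ a
  refine (hQ K hK ξ hξ a).trans ?_
  gcongr

theorem ofReal_mul_rpow_mono {a b R e : ℝ} (hab : a ≤ b) (hR : 0 ≤ R) :
    ENNReal.ofReal (a * R ^ e) ≤ ENNReal.ofReal (b * R ^ e) :=
  ENNReal.ofReal_le_ofReal (by gcongr)

theorem ofReal_rpow_mul_ofReal {a R e f : ℝ} (hR : 0 < R) :
    ENNReal.ofReal (R ^ e) * ENNReal.ofReal (a * R ^ f) = ENNReal.ofReal (a * R ^ (f + e)) := by
  rw [← ENNReal.ofReal_mul (by positivity), Real.rpow_add hR]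
  congr 1
  ring

theorem ofReal_mul_rpow_lt_of_lt {A B c R β e f : ℝ} (hR : 0 < R) (hB : 0 ≤ B) (hc : 0 < c)
    (hlt : A * B / c < R ^ (e - (β + f))) :
    ENNReal.ofReal (A * R ^ β) * ENNReal.ofReal (B * R ^ f) < ENNReal.ofReal (c * R ^ e) := by
  -- The primed version asks for nonnegativity of the second factor only; `A` may be negative.
  rw [← ENNReal.ofReal_mul' (by positivity), ENNReal.ofReal_lt_ofReal_iff (by positivity)]
  have h1 : R ^ e = R ^ (e - (β + f)) * (R ^ β * R ^ f) := by
    rw [← Real.rpow_add hR, ← Real.rpow_add hR]; ring_nf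
  rw [div_lt_iff₀ hc] at hlt
  rw [h1]
  have h2 : 0 < R ^ β * R ^ f := by positivity
  nlinarith [mul_lt_mul_of_pos_right hlt h2]

end BBCRV

end

theorem mainTheorem2 (n d : ℕ) (hd : 2 ≤ d) (hdn : d = n + 1) :
    ∃ c C : ℝ, 0 < c ∧ 0 < C ∧
      ∀ σ α : ℝ, 0 < σ → σ < 1 / 2 → α = d - (d + 1) * σ →
        0 < α ∧
        -- `Y` and `g` satisfy the hypotheses of the estimate, and both sides have the stated size
        (∀ R : ℝ, Real.sqrt d ≤ R →
          (BBCRV.peakCubes n σ R).Finite ∧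
          BBCRV.cubeUnion (BBCRV.peakCubes n σ R) ⊆ Metric.ball 0 R ∧
          BBCRV.HasFractalStructure C α R (BBCRV.cubeUnion (BBCRV.peakCubes n σ R)) ∧
          BBCRV.TubesHitSmallFraction C R (BBCRV.peakCubes n σ R) ∧
          ENNReal.ofReal (c * R ^ (((d : ℝ) - 3) / 2 * σ - ((d : ℝ) - 2) / 2)) ≤
            MeasureTheory.eLpNorm (BBCRV.g n σ R) 2
              (MeasureTheory.volume.restrict (BBCRV.cubeUnion (BBCRV.peakCubes n σ R))) ∧
          MeasureTheory.eLpNorm (BBCRV.g n σ R) 2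
              (MeasureTheory.volume.restrict (BBCRV.cubeUnion (BBCRV.peakCubes n σ R))) ≤
            ENNReal.ofReal (C * R ^ (((d : ℝ) - 3) / 2 * σ - ((d : ℝ) - 2) / 2)) ∧
          ∀ ε : ℝ, 0 ≤ ε →
            ENNReal.ofReal (c * R ^ (((d : ℝ) - 3) / 2 * σ - ((d : ℝ) - 2) / 2 + ε)) ≤
              ENNReal.ofReal (R ^ (1 / ((d : ℝ) + 1) * (α - ((d : ℝ) - 1) / 2) + ε)) *
                MeasureTheory.eLpNorm (BBCRV.h n σ R) 2 (BBCRV.surfaceMeasure n) ∧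
            ENNReal.ofReal (R ^ (1 / ((d : ℝ) + 1) * (α - ((d : ℝ) - 1) / 2) + ε)) *
                MeasureTheory.eLpNorm (BBCRV.h n σ R) 2 (BBCRV.surfaceMeasure n) ≤
              ENNReal.ofReal (C * R ^ (((d : ℝ) - 3) / 2 * σ - ((d : ℝ) - 2) / 2 + ε))) ∧
        -- almost sharpness: the estimate fails with any smaller power of `R`
        (∀ β : ℝ, β < 1 / ((d : ℝ) + 1) * (α - ((d : ℝ) - 1) / 2) → ∀ A : ℝ,
          ∀ᶠ R : ℝ in Filter.atTop,
            ENNReal.ofReal (A * R ^ β) *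
                MeasureTheory.eLpNorm (BBCRV.h n σ R) 2 (BBCRV.surfaceMeasure n) <
              MeasureTheory.eLpNorm (BBCRV.g n σ R) 2
                (MeasureTheory.volume.restrict
                  (BBCRV.cubeUnion (BBCRV.peakCubes n σ R)))) := by
  subst hdn
  have hδ := BBCRV.cohScale_pos n
  set ch : ℝ := √((1 / 2) ^ n) with hch
  set cg : ℝ := (1 / 2) ^ (n + 1) * BBCRV.cohScale n ^ (n + 1) with hcg
  set Cf : ℝ := 5 ^ (n + 1) * 9 ^ (n + 1) with hCf
  set Ct : ℝ := 5 ^ (n + 1) * 25 ^ (n + 1) * ((BBCRV.cohScale n ^ (n + 1)) ^ 2)⁻¹ with hCt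
  set Cg : ℝ := (1 + 4 * n) * 2 ^ n * √(5 ^ (n + 1) * 9 ^ (n + 1)) with hCg
  set Ch : ℝ := √(3 ^ n * ((1 + 4 * n) * 2 ^ n)) with hCh
  have hch0 : 0 < ch := by positivity
  have hcg0 : 0 < cg := by positivity
  have hCf0 : 0 < Cf := by positivity
  have hCt0 : 0 < Ct := by positivity
  have hCg0 : 0 < Cg := by positivity
  have hCh0 : 0 < Ch := by positivity
  refine ⟨min ch cg, Cf + Ct + Cg + Ch, lt_min hch0 hcg0, by positivity, ?_⟩
  intro σ α hσ hσ2 hα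
  have hn1 : (1 : ℝ) ≤ n := by
    have : 1 ≤ n := by omega
    exact_mod_cast this
  have hα' : α = (n : ℝ) * (1 - σ) + (1 - 2 * σ) := by rw [hα]; push_cast; ring
  have hexp : (((n + 1 : ℕ) : ℝ) - 3) / 2 * σ - (((n + 1 : ℕ) : ℝ) - 2) / 2 =
      (n : ℝ) * (σ - 1) + ((n : ℝ) * (1 - σ) + (1 - 2 * σ)) / 2 := by push_cast; ring
  have hgain : 1 / (((n + 1 : ℕ) : ℝ) + 1) * (α - (((n + 1 : ℕ) : ℝ) - 1) / 2) = 1 / 2 - σ := by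
    rw [hα]; push_cast; field_simp; ring
  -- The identity behind sharpness: the exponent of `‖h‖₂` plus the gain `1/2 - σ` is the exponent
  -- of `‖g‖_{L²(Y)}`.
  have hsplit : ∀ ε : ℝ, (n : ℝ) * (σ - 1) / 2 + (1 / 2 - σ + ε) =
      (n : ℝ) * (σ - 1) + ((n : ℝ) * (1 - σ) + (1 - 2 * σ)) / 2 + ε := fun ε => by ring
  have hone : ∀ R : ℝ, √((n + 1 : ℕ) : ℝ) ≤ R → 1 < R := fun R hR => by
    refine lt_of_lt_of_le ?_ hR
    rw [Real.lt_sqrt (by norm_num)]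
    push_cast
    linarith
  rw [hexp, hgain]
  refine ⟨by rw [hα']; nlinarith, fun R hR => ?_, fun β hβ A => ?_⟩
  · have hR1 := hone R hR
    have hR0 : 0 < R := by linarith
    refine ⟨BBCRV.finite_peakCubes n σ R, BBCRV.cubeUnion_peakCubes_subset n σ R, ?_, ?_, ?_, ?_,
      fun ε _ => ⟨?_, ?_⟩⟩
    · rw [hα']
      exact (BBCRV.hasFractalStructure_peakCubes n hσ hσ2 hR1.le).mono (by linarith)
    · exact (BBCRV.tubesHitSmallFraction_peakCubes n hσ hσ2 hR hR1.le).mono (by linarith) hR0.le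
    · exact (BBCRV.ofReal_mul_rpow_mono (min_le_right _ _) hR0.le).trans
        (BBCRV.le_eLpNorm_g n hσ hR hR1)
    · exact (BBCRV.eLpNorm_g_le n hσ hσ2 hR1).trans
        (BBCRV.ofReal_mul_rpow_mono (by linarith) hR0.le)
    · refine le_trans ?_ (mul_le_mul_right (BBCRV.le_eLpNorm_h n hσ hR1) _)
      rw [BBCRV.ofReal_rpow_mul_ofReal hR0, hsplit]
      exact BBCRV.ofReal_mul_rpow_mono (min_le_left _ _) hR0.le
    · refine (mul_le_mul_right (BBCRV.eLpNorm_h_le n hσ (by linarith) hR1) _).trans ?_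
      rw [BBCRV.ofReal_rpow_mul_ofReal hR0, hsplit]
      exact BBCRV.ofReal_mul_rpow_mono (by linarith) hR0.le
  -- This difference equals `1/2 - σ - β`, so that power of `R` eventually exceeds any constant.
  · have hpos : 0 < (n : ℝ) * (σ - 1) + ((n : ℝ) * (1 - σ) + (1 - 2 * σ)) / 2 -
        (β + (n : ℝ) * (σ - 1) / 2) := by linarith
    filter_upwards [(tendsto_rpow_atTop hpos).eventually_gt_atTop (A * Ch / cg),
      Filter.eventually_ge_atTop (√((n + 1 : ℕ) : ℝ))] with R hlarge hR
    have hR1 := hone R hR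
    have hR0 : 0 < R := by linarith
    calc _ ≤ ENNReal.ofReal (A * R ^ β) *
          ENNReal.ofReal (Ch * R ^ ((n : ℝ) * (σ - 1) / 2)) := by
          gcongr
          exact BBCRV.eLpNorm_h_le n hσ (by linarith) hR1
      _ < _ := BBCRV.ofReal_mul_rpow_lt_of_lt hR0 hCh0.le hcg0 hlarge
      _ ≤ _ := BBCRV.le_eLpNorm_g n hσ hR hR1
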